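/- Let $\Bbbk$ be a field of characteristic $0$, $\lambda\in\Bbbk$, and $(A,\mu)$ an associative (not necessarily unital) $\Bbbk$-algebra, placed in degree $0$ (homological grading); $s$ denotes suspension, $|s|=1$. Put $\mathfrak C_{\mathrm{Alg}}(A)=\bigoplus_{n\ge 0}\mathrm{Hom}((sA)^{\otimes n},sA)$, $\mathfrak C_{\mathrm{RBO}}(A)=\bigoplus_{n\ge 0}\mathrm{Hom}((sA)^{\otimes n},A)$ (so $\mathrm{Hom}((sA)^{\otimes n},A)$ has degree $-n$) and $\mathfrak C_{\mathrm{RBA}}(A)=\mathfrak C_{\mathrm{Alg}}(A)\oplus\mathfrak C_{\mathrm{RBO}}(A)$. All signs follow the Koszul rule, and $f\{g_1,\dots,g_n\}$ denotes the brace on $\mathfrak C_{\mathrm{Alg}}(A)$: the signed sum of all insertions of $g_1,\dots,g_n$, in this order, into inputs of $f$ (and $f\{\}=f$). The space $\mathfrak C_{\mathrm{RBA}}(A)$ carries the multilinear operations $\{l_n\}_{n\ge1}$ with the following nonzero components: $l_1(sh)=h$ for $h\in A$; $l_2$ on $\mathfrak C_{\mathrm{Alg}}(A)$ is the Gerstenhaber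 bracket $[f,g]_G=f\{g\}-(-1)^{|f||g|}g\{f\}$; for homogeneous $sh\in\mathrm{Hom}((sA)^{\otimes p},sA)$ and $g_1,\dots,g_n\in\mathfrak C_{\mathrm{RBO}}(A)$ with $1\le n\le p$, $$l_{n+1}(sh\otimes g_1\otimes\cdots\otimes g_n)=\sum_{\sigma\in S_n}(-1)^{\eta_\sigma}\Big(\delta_{n,p}\,h\circ(sg_{\sigma(1)}\otimes\cdots\otimes sg_{\sigma(n)})-(-1)^{(|g_{\sigma(1)}|+1)(|h|+1)}\lambda^{p-n}s^{-1}(sg_{\sigma(1)})\{sh\{sg_{\sigma(2)},\dots,sg_{\sigma(n)}\}\}\Big)$$ (with $\lambda^0=1$), where $(-1)^{\eta_\sigma}=\chi(\sigma;g_1,\dots,g_n)(-1)^{n(|h|+1)+\sum_{k=1}^{n-1}\sum_{j=1}^{k}|g_{\sigma(j)}|}$ and $\chi$ is the graded-exterior (antisymmetric) Koszul sign; and the values with $sh$ in another position are determined by graded antisymmetry. Let $m=-s\circ\mu\circ(s^{-1}\otimes s^{-1})$ and $\alpha=(m,0)\in\mathfrak C_{\mathrm{RBA}}(A)_{-1}$,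 and let $$l_n^\alpha(x_1\otimes\cdots\otimes x_n)=\sum_{i\ge0}\frac{1}{i!}(-1)^{in+\frac{i(i-1)}2}l_{n+i}(\alpha^{\otimes i}\otimes x_1\otimes\cdots\otimes x_n).$$ Then the following hold. (1) $\alpha$ satisfies the Maurer–Cartan equation $\sum_{n\ge1}\frac1{n!}(-1)^{\frac{n(n-1)}2}l_n(\alpha^{\otimes n})=0$ (a finite sum); the sums defining $l_n^\alpha$ are finite; $\mathfrak C_{\mathrm{RBO}}(A)$ is closed under all $l_n^\alpha$, $n\ge 1$; and $l_n^\alpha$ vanishes on $\mathfrak C_{\mathrm{RBO}}(A)$ for $n\ge3$. (2) $(\mathfrak C_{\mathrm{RBO}}(A),l_1^\alpha,l_2^\alpha)$, with the restricted operations, is a dg Lie algebra ($|l_1^\alpha|=-1$, $|l_2^\alpha|=0$). (3) $T\mapsto T\circ s^{-1}$ is a bijection from the set of Rota–Baxter operators of weight $\lambda$ on $(A,\mu)$, i.e. linear maps $T:A\to A$ with $T(a)T(b)=T(aT(b)+T(a)b+\lambda ab)$ for all $a,b\in A$, onto the set of Maurer–Cartan elements of this dg Lie algebra, i.e. the elements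 $\beta$ of degree $-1$ with $l_1^\alpha(\beta)-\frac12l_2^\alpha(\beta\otimes\beta)=0$. (4) Let $T$ be a Rota–Baxter operator of weight $\lambda$ and $\beta=T\circ s^{-1}$. Under the isomorphisms $\mathrm{Hom}((sA)^{\otimes n},A)\cong\mathrm{Hom}(A^{\otimes n},A)$, $g\mapsto g\circ s^{\otimes n}$ ($n\ge0$), the differential $x\mapsto l_1^\alpha(x)-l_2^\alpha(\beta\otimes x)$ of the dg Lie algebra twisted by $\beta$ is the differential $\partial^n$ of the cochain complex $C^\bullet_{\mathrm{RBO}}(A)$ of $T$, $C^n_{\mathrm{RBO}}(A)=\mathrm{Hom}(A^{\otimes n},A)$. This complex is the Hochschild complex of the associative algebra $(A,\star)$, $a\star b=aT(b)+T(a)b+\lambda ab$, with coefficients in $A$ with the actions $a\rhd x=T(a)x-T(ax)$ and $x\lhd a=xT(a)-T(xa)$: $$\partial^n(f)(a_1,\dots,a_{n+1})=(-1)^{n+1}a_1\rhd f(a_2,\dots,a_{n+1})+\sum_{i=1}^n(-1)^{n-i+1}f(a_1,\dots,a_i\star a_{i+1},\dots,a_{n+1})+f(a_1,\dots,a_n)\lhd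 a_{n+1},$$ and $\partial^{n+1}\circ\partial^n=0$. -/

import Mathlib

namespace RotaBaxter

/-! ### Differential graded Lie algebras -/

section DGLie

/-- A differential graded Lie algebra structure (homological grading, `|l₁| = -1`, `|l₂| = 0`)
on a `k`-module `L` graded by the submodules `𝓛 i`, `i : ℤ`. -/
structure DGLieAlgebra (k : Type*) [Field k] (L : Type*) [AddCommGroup L] [Module k L]
    (𝓛 : ℤ → Submodule k L) where
  l₁ : L →ₗ[k] L
  l₂ : L →ₗ[k] L →ₗ[k] L
  internal : DirectSum.IsInternal 𝓛
  l₁_mem : ∀ (i : ℤ) (x : L), x ∈ 𝓛 i → l₁ x ∈ 𝓛 (i - 1)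
  l₂_mem : ∀ (i j : ℤ) (x y : L), x ∈ 𝓛 i → y ∈ 𝓛 j → l₂ x y ∈ 𝓛 (i + j)
  l₁_l₁ : ∀ x : L, l₁ (l₁ x) = 0
  l₁_l₂ : ∀ (i : ℤ) (x y : L), x ∈ 𝓛 i →
    l₁ (l₂ x y) = l₂ (l₁ x) y + i.negOnePow • l₂ x (l₁ y)
  antisymm : ∀ (i j : ℤ) (x y : L), x ∈ 𝓛 i → y ∈ 𝓛 j →
    l₂ x y + (i * j).negOnePow • l₂ y x = 0
  jacobi : ∀ (a b c : ℤ) (x y z : L), x ∈ 𝓛 a → y ∈ 𝓛 b → z ∈ 𝓛 c →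
    l₂ (l₂ x y) z + (a * (b + c)).negOnePow • l₂ (l₂ y z) x
      + (c * (a + b)).negOnePow • l₂ (l₂ z x) y = 0

namespace DGLieAlgebra

variable {k : Type*} [Field k] {L : Type*} [AddCommGroup L] [Module k L]
  {𝓛 : ℤ → Submodule k L}

/-- Maurer-Cartan elements: degree `-1` and `l₁(α) - ½ l₂(α ⊗ α) = 0`. -/
def IsMaurerCartan (D : DGLieAlgebra k L 𝓛) (α : L) : Prop :=
  α ∈ 𝓛 (-1) ∧ D.l₁ α - (1 / 2 : k) • D.l₂ α α = 0

theorem eq_zero_of_homogeneous (D : DGLieAlgebra k L 𝓛) (phi : L →ₗ[k] L)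
    (h : ∀ (i : ℤ) (x : L), x ∈ 𝓛 i → phi x = 0) (x : L) : phi x = 0 := by
  have htop : (⨆ i, 𝓛 i) = ⊤ := D.internal.submodule_iSup_eq_top
  have hle : (⨆ i, 𝓛 i) ≤ LinearMap.ker phi := iSup_le fun i y hy => h i y hy
  have hx : x ∈ (⨆ i, 𝓛 i) := by rw [htop]; trivial
  exact hle hx

/-- The dg Lie algebra twisted by a Maurer-Cartan element `α`:
`l₁^α(x) = l₁(x) - l₂(α ⊗ x)` and `l₂^α = l₂`. -/
def twist [CharZero k] (D : DGLieAlgebra k L 𝓛) (α : L) (hα : D.IsMaurerCartan α) :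
    DGLieAlgebra k L 𝓛 where
  l₁ := D.l₁ - D.l₂ α
  l₂ := D.l₂
  internal := D.internal
  l₁_mem i x hx := by
    have h := D.l₂_mem (-1) i α x hα.1 hx
    rw [neg_add_eq_sub] at h
    exact (𝓛 (i - 1)).sub_mem (D.l₁_mem i x hx) h
  l₂_mem := D.l₂_mem
  l₁_l₁ := by
    have key := D.eq_zero_of_homogeneous ((D.l₁ - D.l₂ α) ∘ₗ (D.l₁ - D.l₂ α)) (by
      intro i x hx
      have hmc := sub_eq_zero.mp hα.2
      have h1 := D.l₁_l₂ (-1) α x hα.1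
      have h2 := D.jacobi (-1) (-1) i α α x hα.1 hα.1 hx
      have h3 := D.antisymm (i - 1) (-1) (D.l₂ α x) α
        (by rw [← neg_add_eq_sub]; exact D.l₂_mem (-1) i α x hα.1 hx) hα.1
      have h4 := D.antisymm i (-1) x α hx hα.1
      have e4 : D.l₂ x α = -((i * -1).negOnePow • D.l₂ α x) := eq_neg_of_add_eq_zero_left h4
      have e3 : D.l₂ (D.l₂ α x) α = -(((i - 1) * -1).negOnePow • D.l₂ α (D.l₂ α x)) :=
        eq_neg_of_add_eq_zero_left h3
      rw [hmc] at h1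
      simp only [LinearMap.comp_apply, LinearMap.sub_apply, map_sub]
      rw [D.l₁_l₁, h1, map_smul, LinearMap.smul_apply]
      rw [e4] at h2
      have e5 : D.l₂ (-((i * -1).negOnePow • D.l₂ α x)) α
          = (i * -1).negOnePow • ((i - 1) * -1).negOnePow • D.l₂ α (D.l₂ α x) := by
        rw [map_neg, LinearMap.neg_apply, Units.smul_def, map_zsmul, LinearMap.smul_apply, e3]
        simp [Units.smul_def]
      rw [e5, e3] at h2
      rcases Int.even_or_odd i with hi | hi
      · have a1 : ((-1 : ℤ) * (-1 + i)).negOnePow = -1 :=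
          Int.negOnePow_odd _ (by obtain ⟨r, rfl⟩ := hi; exact ⟨-r, by ring⟩)
        have a2 : ((i - 1) * -1).negOnePow = -1 :=
          Int.negOnePow_odd _ (by obtain ⟨r, rfl⟩ := hi; exact ⟨-r, by ring⟩)
        have a3 : (i * (-1 + -1)).negOnePow = 1 :=
          Int.negOnePow_even _ (by exact ⟨-i, by ring⟩)
        have a4 : (i * -1).negOnePow = 1 :=
          Int.negOnePow_even _ (by obtain ⟨r, rfl⟩ := hi; exact ⟨-r, by ring⟩)
        have a5 : (-1 : ℤ).negOnePow = -1 := Int.negOnePow_odd _ ⟨-1, by ring⟩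
        rw [a1, a2, a3, a4] at h2
        rw [a5]
        simp only [Units.neg_smul, one_smul, neg_neg] at h2 ⊢
        have h6 : D.l₂ (D.l₂ α α) x = (2 : k) • D.l₂ α (D.l₂ α x) := by
          rw [two_smul, ← sub_eq_zero, ← h2]; abel
        rw [h6, smul_smul]
        norm_num
      · have a1 : ((-1 : ℤ) * (-1 + i)).negOnePow = 1 :=
          Int.negOnePow_even _ (by obtain ⟨r, rfl⟩ := hi; exact ⟨-r, by ring⟩)
        have a2 : ((i - 1) * -1).negOnePow = 1 :=
          Int.negOnePow_even _ (by obtain ⟨r, rfl⟩ := hi; exact ⟨-r, by ring⟩)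
        have a3 : (i * (-1 + -1)).negOnePow = 1 :=
          Int.negOnePow_even _ (by exact ⟨-i, by ring⟩)
        have a4 : (i * -1).negOnePow = -1 :=
          Int.negOnePow_odd _ (by obtain ⟨r, rfl⟩ := hi; exact ⟨-r - 1, by ring⟩)
        have a5 : (-1 : ℤ).negOnePow = -1 := Int.negOnePow_odd _ ⟨-1, by ring⟩
        rw [a1, a2, a3, a4] at h2
        rw [a5]
        simp only [Units.neg_smul, one_smul, neg_neg] at h2 ⊢
        have h6 : D.l₂ (D.l₂ α α) x = (2 : k) • D.l₂ α (D.l₂ α x) := by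
          rw [two_smul, ← sub_eq_zero, ← h2]; abel
        rw [h6, smul_smul]
        norm_num)
    intro x
    exact key x
  l₁_l₂ := by
    intro i x y hx
    have key := D.eq_zero_of_homogeneous
      ((D.l₁ - D.l₂ α) ∘ₗ D.l₂ x - D.l₂ ((D.l₁ - D.l₂ α) x)
        - i.negOnePow • (D.l₂ x ∘ₗ (D.l₁ - D.l₂ α))) (by
      intro j y hy
      have h1 := D.l₁_l₂ i x y hx
      have h2 := D.jacobi (-1) i j α x y hα.1 hx hy
      have h3 := D.antisymm (i + j) (-1) (D.l₂ x y) α (D.l₂_mem i j x y hx hy) hα.1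
      have h4 := D.antisymm j (-1) y α hy hα.1
      have h5 := D.antisymm (j - 1) i (D.l₂ α y) x
        (by rw [← neg_add_eq_sub]; exact D.l₂_mem (-1) j α y hα.1 hy) hx
      have e3 := eq_neg_of_add_eq_zero_left h3
      have e4 := eq_neg_of_add_eq_zero_left h4
      have e5 := eq_neg_of_add_eq_zero_left h5
      rw [e3, e4, map_neg, LinearMap.neg_apply, Units.smul_def, Units.smul_def, Units.smul_def,
        Units.smul_def, map_zsmul, LinearMap.smul_apply, e5] at h2
      simp only [LinearMap.sub_apply, LinearMap.comp_apply, LinearMap.smul_apply, map_sub,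
        Units.smul_def]
      rw [h1]
      simp only [Units.smul_def, smul_neg, neg_neg, smul_smul, ← Units.val_mul,
        ← Int.negOnePow_add] at h2 ⊢
      have p1 : (-1 * (i + j) + (i + j) * -1).negOnePow = 1 :=
        Int.negOnePow_even _ ⟨-(i + j), by ring⟩
      have p2 : (j * (-1 + i) + (j * -1 + (j - 1) * i)).negOnePow = i.negOnePow := by
        rw [show j * (-1 + i) + (j * -1 + (j - 1) * i) = 2 * (j * i - j - i) + i by ring,
          Int.negOnePow_add, Int.negOnePow_even _ (even_two_mul _), one_mul]
      rw [p1, p2] at h2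
      simp only [Units.val_one, one_smul, smul_sub] at h2 ⊢
      have h7 : D.l₂ α (D.l₂ x y) = D.l₂ (D.l₂ α x) y
          + ((i.negOnePow : ℤˣ) : ℤ) • D.l₂ x (D.l₂ α y) := by
        rw [← sub_eq_zero, ← neg_eq_zero, ← h2]; abel
      rw [h7]
      abel) y
    simp only [LinearMap.sub_apply, LinearMap.comp_apply, LinearMap.smul_apply] at key
    rw [sub_sub, sub_eq_zero] at key
    exact key
  antisymm := D.antisymm
  jacobi := D.jacobi

end DGLieAlgebra

end DGLie

/-! ### The suspension and the graded spaces

The space `A` sits in degree `0`, so its suspension `sA` sits in degree `1`, `(sA)^{⊗ n}` in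
degree `n`, `Hom((sA)^{⊗ n}, sA)` in degree `1 - n` and `Hom((sA)^{⊗ n}, A)` in degree `-n`.
A linear map out of `(sA)^{⊗ n}` is written as an `n`-linear map on `sA`. -/

section Spaces

/-- The suspension `sA` (a copy of `A`, placed in degree `1`). -/
def Susp (A : Type*) : Type _ := A

instance (A : Type*) [AddCommGroup A] : AddCommGroup (Susp A) := inferInstanceAs (AddCommGroup A)

instance (k A : Type*) [Field k] [AddCommGroup A] [Module k A] : Module k (Susp A) :=
  inferInstanceAs (Module k A)

/-- The suspension map `s : A → sA`. -/
def susp (k A : Type*) [Field k] [AddCommGroup A] [Module k A] : A ≃ₗ[k] Susp A :=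
  LinearEquiv.refl k A

variable (k : Type*) [Field k] (A : Type*) [AddCommGroup A] [Module k A]

/-- `Hom((sA)^{⊗ n}, sA)`. -/
abbrev HomAlg (n : ℕ) : Type _ := MultilinearMap k (fun _ : Fin n => Susp A) (Susp A)

/-- `Hom((sA)^{⊗ n}, A)`. -/
abbrev HomRBO (n : ℕ) : Type _ := MultilinearMap k (fun _ : Fin n => Susp A) A

/-- `𝔠_Alg(A) = Hom(T^c(sA), sA)`, the direct sum of its homogeneous components. -/
abbrev CAlg : Type _ := Π₀ n : ℕ, HomAlg k A n

/-- `𝔠_RBO(A) = Hom(T^c(sA), A)`, the direct sum of its homogeneous components. -/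
abbrev CRBO : Type _ := Π₀ n : ℕ, HomRBO k A n

/-- `𝔠_RBA(A) = 𝔠_Alg(A) ⊕ 𝔠_RBO(A)`. -/
abbrev CRBA : Type _ := CAlg k A × CRBO k A

/-- The degree `d` part of `𝔠_Alg(A)`. -/
def algDegree (d : ℤ) : Submodule k (CAlg k A) where
  carrier := {f | ∀ n : ℕ, d ≠ 1 - (n : ℤ) → f n = 0}
  add_mem' hf hg n hn := by simp [hf n hn, hg n hn]
  zero_mem' n _ := rfl
  smul_mem' c f hf n hn := by simp [hf n hn]

/-- The degree `d` part of `𝔠_RBO(A)`. -/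
def rboDegree (d : ℤ) : Submodule k (CRBO k A) where
  carrier := {f | ∀ n : ℕ, d ≠ -(n : ℤ) → f n = 0}
  add_mem' hf hg n hn := by simp [hf n hn, hg n hn]
  zero_mem' n _ := rfl
  smul_mem' c f hf n hn := by simp [hf n hn]

/-- The degree `d` part of `𝔠_RBA(A)`. -/
def rbaDegree (d : ℤ) : Submodule k (CRBA k A) := (algDegree k A d).prod (rboDegree k A d)

/-- The isomorphism `g ↦ sg = s ∘ g` from `𝔠_RBO(A)` to `𝔠_Alg(A)`; its inverse is
`f ↦ s⁻¹ ∘ f`. -/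
noncomputable def suspCochain : CRBO k A ≃ₗ[k] CAlg k A :=
  DFinsupp.mapRange.linearEquiv fun _ => LinearEquiv.multilinearMapCongrRight k (susp k A)

end Spaces

/-! ### Braces and the Gerstenhaber bracket on `𝔠_Alg(A)` -/

section Brace

variable {k : Type*} [Field k] {A : Type*} [AddCommGroup A] [Module k A]

/-- The map filling the `m` slots of an `m`-ary map: the `i`-th of the `gᵢ` goes into slot `e i`,
the identity of `sA` into all other slots. -/
noncomputable def slots {m n : ℕ} (e : Fin n ↪o Fin m) (g : Fin n → Σ l : ℕ, HomAlg k A l) :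
    Fin m → Σ l : ℕ, HomAlg k A l :=
  Function.extend e g fun _ =>
    ⟨1, MultilinearMap.ofSubsingleton k (Susp A) (Susp A) (0 : Fin 1) LinearMap.id⟩

/-- `f(c₀(…), …, c_{m-1}(…))`, each `c_j` being applied to its own block of consecutive
arguments (no signs). -/
noncomputable def plug {m : ℕ} (f : HomAlg k A m) (c : Fin m → Σ l : ℕ, HomAlg k A l) :
    HomAlg k A (∑ j, (c j).1) :=
  MultilinearMap.domDomCongr finSigmaFinEquiv (f.compMultilinearMap fun j => (c j).2)

/-- The brace `sf{sg₁, …, sgₙ}` of homogeneous elements. A summand is given by the increasing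
choice `e` of the slots of `f` that receive `sg₁, …, sgₙ`; its sign exponent is
`∑ₖ |sgₖ| · iₖ` with `|sgₖ| = 1 - lₖ` and `iₖ` the number of arguments (all of degree `1`)
to the left of those of `gₖ`. -/
noncomputable def braceHom {m : ℕ} (f : HomAlg k A m) (gs : List (Σ l : ℕ, HomAlg k A l)) :
    CAlg k A :=
  ∑ e : Fin gs.length ↪o Fin m,
    (∑ i : Fin gs.length, (1 - ((gs.get i).1 : ℤ)) *
      ∑ j ∈ Finset.Iio (e i), ((slots e gs.get j).1 : ℤ)).negOnePow •
        DFinsupp.single _ (plug f (slots e gs.get))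

open scoped Classical in
/-- Extension by multilinearity of a function of homogeneous elements of `𝔠_Alg(A)`. -/
noncomputable def extendAlg {M : Type*} [AddCommMonoid M]
    (phi : List (Σ l : ℕ, HomAlg k A l) → M) : List (CAlg k A) → M
  | [] => phi []
  | x :: xs => DFinsupp.sum x fun l g => extendAlg (fun ys => phi (⟨l, g⟩ :: ys)) xs

open scoped Classical in
/-- The brace `f{g₁, …, gₙ}` on `𝔠_Alg(A)`; in particular `f{} = f`. -/
noncomputable def brace (f : CAlg k A) (gs : List (CAlg k A)) : CAlg k A :=
  DFinsupp.sum f fun _ F => extendAlg (braceHom F) gs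

/-- The Gerstenhaber bracket of homogeneous elements (of degrees `1 - m` and `1 - n`). -/
noncomputable def gerstenhaberHom {m n : ℕ} (f : HomAlg k A m) (g : HomAlg k A n) : CAlg k A :=
  brace (DFinsupp.single m f) [DFinsupp.single n g]
    - ((1 - (m : ℤ)) * (1 - (n : ℤ))).negOnePow •
        brace (DFinsupp.single n g) [DFinsupp.single m f]

end Brace

/-! ### The operations `lₙ` on `𝔠_RBA(A)` -/

section Operations

/-- The Koszul sign `χ(σ; x₁, …, xₙ)` of the graded exterior algebra, for elements of degrees
`d i`: `x₁ ∧ ⋯ ∧ xₙ = χ · x_{σ(1)} ∧ ⋯ ∧ x_{σ(n)}`. -/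
def koszulChi {n : ℕ} (σ : Equiv.Perm (Fin n)) (d : Fin n → ℤ) : ℤˣ :=
  Equiv.Perm.sign σ *
    ∏ i : Fin n, ∏ j : Fin n, if i < j ∧ σ j < σ i then (d (σ i) * d (σ j)).negOnePow else 1

variable {k : Type*} [Field k] {A : Type*} [AddCommGroup A] [Module k A]

/-- The homogeneous component `g` of arity `l` of `𝔠_RBO(A)`, sent to `sg ∈ 𝔠_Alg(A)`. -/
noncomputable def suspHom (g : Σ l : ℕ, HomRBO k A l) : CAlg k A :=
  suspCochain k A (DFinsupp.single g.1 g.2)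

/-- `l_{n+1}(sh ⊗ g₁ ⊗ ⋯ ⊗ gₙ)` for `n = q + 1`, `sh ∈ Hom((sA)^{⊗ p}, sA)` (so `|h| + 1 = 1 - p`)
and homogeneous `gᵢ ∈ 𝔠_RBO(A)`, in weight `lam`. For `n = p` the brace `sh{sg₁, …, sgₙ}` is
`sh ∘ (sg₁ ⊗ ⋯ ⊗ sgₙ)` since every slot of `h` is filled. -/
noncomputable def lMixed (lam : k) {p : ℕ} (h : HomAlg k A p) {q : ℕ}
    (g : Fin (q + 1) → Σ l : ℕ, HomRBO k A l) : CRBO k A :=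
  let d : Fin (q + 1) → ℤ := fun i => -((g i).1 : ℤ)
  ∑ σ : Equiv.Perm (Fin (q + 1)),
    let sgn : ℤˣ := koszulChi σ d *
      (((q : ℤ) + 1) * (1 - (p : ℤ))
        + ∑ r : Fin q, ∑ j ∈ Finset.Iic r.castSucc, d (σ j)).negOnePow
    let sgn' : ℤˣ := ((d (σ 0) + 1) * (1 - (p : ℤ))).negOnePow
    let nested : CRBO k A := (suspCochain k A).symm
      (brace (suspHom (g (σ 0)))
        [brace (DFinsupp.single p h) (List.ofFn fun i : Fin q => suspHom (g (σ i.succ)))])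
    if q + 1 = p then
      sgn • ((suspCochain k A).symm
          (brace (DFinsupp.single p h) (List.ofFn fun i : Fin (q + 1) => suspHom (g (σ i))))
        - sgn' • nested)
    else if q + 1 < p then
      (-(sgn * sgn')) • lam ^ (p - (q + 1)) • nested
    else 0

variable (k A) in
/-- Homogeneous elements of one of the two summands of `𝔠_RBA(A)`. -/
inductive HomElt : Type _
  | alg (n : ℕ) (f : HomAlg k A n) : HomElt
  | rbo (n : ℕ) (g : HomRBO k A n) : HomElt

/-- If all the entries belong to `𝔠_RBO(A)`, the list of these. -/
def allRBO : List (HomElt k A) → Option (List (Σ l : ℕ, HomRBO k A l))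
  | [] => some []
  | .rbo n g :: xs => (allRBO xs).map fun gs => ⟨n, g⟩ :: gs
  | .alg _ _ :: _ => none

/-- If exactly one entry belongs to `𝔠_Alg(A)`: the entries before it, this entry, and the
entries after it. -/
def isolate : List (HomElt k A) →
    Option (List (Σ l : ℕ, HomRBO k A l) × (Σ p : ℕ, HomAlg k A p) ×
      List (Σ l : ℕ, HomRBO k A l))
  | [] => none
  | .rbo n g :: xs => (isolate xs).map fun t => (⟨n, g⟩ :: t.1, t.2)
  | .alg p h :: xs => (allRBO xs).map fun gs => ([], ⟨p, h⟩, gs)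

/-- `lₙ(x₁ ⊗ ⋯ ⊗ xₙ)` for homogeneous `xᵢ`, `n` being the length of the list:
`l₁(sh) = h` for `h ∈ A`, `l₂` is the Gerstenhaber bracket on `𝔠_Alg(A)`, and if exactly one
`sh` of the entries lies in `𝔠_Alg(A)`, it is moved to the front with its Koszul sign and
`lMixed` is applied. All other components vanish. -/
noncomputable def lHom (lam : k) : List (HomElt k A) → CRBA k A
  | [.alg 0 h] => (0, (suspCochain k A).symm (DFinsupp.single 0 h))
  | [.alg _ f, .alg _ h] => (gerstenhaberHom f h, 0)
  | xs =>
    match isolate xs with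
    | some (gs₁, ⟨p, h⟩, gs₂) =>
      (0, ((1 - (p : ℤ)) * (gs₁.map fun g => -(g.1 : ℤ)).sum + (gs₁.length : ℤ)).negOnePow •
        match gs₁ ++ gs₂ with
        | [] => 0
        | g :: gs => lMixed lam h fun i : Fin (gs.length + 1) => (g :: gs).get i)
    | none => 0

open scoped Classical in
/-- Extension by multilinearity of a function of homogeneous elements of `𝔠_RBA(A)`. -/
noncomputable def extendRBA {M : Type*} [AddCommMonoid M]
    (phi : List (HomElt k A) → M) : List (CRBA k A) → M
  | [] => phi []
  | x :: xs =>
    DFinsupp.sum x.1 (fun n f => extendRBA (fun ys => phi (.alg n f :: ys)) xs)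
      + DFinsupp.sum x.2 (fun n g => extendRBA (fun ys => phi (.rbo n g :: ys)) xs)

/-- The operations of the `L_∞`-algebra `𝔠_RBA(A)` in weight `lam`:
`lOp lam [x₁, …, xₙ] = lₙ(x₁ ⊗ ⋯ ⊗ xₙ)`. -/
noncomputable def lOp (lam : k) (xs : List (CRBA k A)) : CRBA k A :=
  extendRBA (lHom lam) xs

/-- The `i`-th summand of the twisted operation `lₙ^α(x₁ ⊗ ⋯ ⊗ xₙ)`. -/
noncomputable def twistedTerm (lam : k) (α : CRBA k A) (xs : List (CRBA k A)) (i : ℕ) :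
    CRBA k A :=
  ((i.factorial : k)⁻¹ * (-1) ^ (i * xs.length + i * (i - 1) / 2)) •
    lOp lam (List.replicate i α ++ xs)

/-- The twisted operation `lₙ^α(x₁ ⊗ ⋯ ⊗ xₙ)` (meaningful if only finitely many summands are
nonzero). -/
noncomputable def twistedOp (lam : k) (α : CRBA k A) (xs : List (CRBA k A)) : CRBA k A :=
  ∑ᶠ i : ℕ, twistedTerm lam α xs i

/-- The summand of index `n + 1` of the Maurer-Cartan equation in `𝔠_RBA(A)`. -/
noncomputable def mcTerm (lam : k) (α : CRBA k A) (n : ℕ) : CRBA k A :=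
  (((n + 1).factorial : k)⁻¹ * (-1) ^ ((n + 1) * n / 2)) • lOp lam (List.replicate (n + 1) α)

/-- Maurer-Cartan elements of `𝔠_RBA(A)`: degree `-1`, the sum of the Maurer-Cartan equation
exists, and it vanishes. -/
def IsMaurerCartanRBA (lam : k) (α : CRBA k A) : Prop :=
  α ∈ rbaDegree k A (-1) ∧ (Function.support (mcTerm lam α)).Finite ∧
    ∑ᶠ n : ℕ, mcTerm lam α n = 0

end Operations

/-! ### Rota-Baxter operators and their cochain complex -/

section RotaBaxterOperators

variable {k : Type*} [Field k] {A : Type*} [NonUnitalRing A] [Module k A]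

/-- Rota-Baxter operators of weight `lam` on the associative algebra `A`. -/
def IsRotaBaxter (lam : k) (T : A →ₗ[k] A) : Prop :=
  ∀ a b : A, T a * T b = T (a * T b + T a * b + lam • (a * b))

variable [IsScalarTower k A A] [SMulCommClass k A A]

variable (k A) in
/-- `m = -s ∘ μ ∘ (s⁻¹ ⊗ s⁻¹)`. By the Koszul rule `(s⁻¹ ⊗ s⁻¹)(sa ⊗ sb) = -a ⊗ b`, whence
`m(sa ⊗ sb) = s(ab)`. -/
def mulCochain : HomAlg k A 2 where
  toFun v := susp k A ((susp k A).symm (v 0) * (susp k A).symm (v 1))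
  map_update_add' v i x y := by
    fin_cases i <;> simp [Function.update, add_mul, mul_add]
  map_update_smul' v i c x := by
    fin_cases i <;> simp [Function.update, smul_mul_assoc, mul_smul_comm]

variable (k A) in
/-- The Maurer-Cartan element `α = (m, 0)` of `𝔠_RBA(A)` given by the product of `A`. -/
noncomputable def mulElement : CRBA k A := (DFinsupp.single 2 (mulCochain k A), 0)

/-- The element `T ∘ s⁻¹` of `Hom(sA, A) ⊆ 𝔠_RBO(A)`. -/
noncomputable def operatorElement (T : A →ₗ[k] A) : CRBO k A :=
  DFinsupp.single 1
    (MultilinearMap.ofSubsingleton k (Susp A) A (0 : Fin 1) (T ∘ₗ (susp k A).symm.toLinearMap))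

theorem contractNth_update_mul {B : Type*} (op : B → B → B) {n : ℕ} (i : Fin n)
    (v : Fin (n + 1) → B) (p : Fin (n + 1)) (x : B) :
    Fin.contractNth i.castSucc op (Function.update v p x) =
      Function.update (Fin.contractNth i.castSucc op v)
        (if h : (p : ℕ) ≤ i then ⟨p, by omega⟩ else ⟨p - 1, by omega⟩)
        (if p = i.castSucc then op x (v i.succ)
          else if p = i.succ then op (v i.castSucc) x else x) := by
  ext j
  obtain ⟨j, hj⟩ := j
  obtain ⟨p, hp⟩ := p
  obtain ⟨i, hi⟩ := i
  simp only [Fin.contractNth, Function.update_apply, Fin.castSucc_mk, Fin.succ_mk, Fin.mk.injEq]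
  grind

/-- The inner summand `f(a₁, …, aᵢ ⋆ aᵢ₊₁, …, aₙ₊₁)` of the Hochschild differential of a
bilinear product. -/
def contractMap {M : Type*} [AddCommGroup M] [Module k M] (star : A →ₗ[k] A →ₗ[k] A) {n : ℕ}
    (f : MultilinearMap k (fun _ : Fin n => A) M) (i : Fin n) :
    MultilinearMap k (fun _ : Fin (n + 1) => A) M where
  toFun a := f (Fin.contractNth i.castSucc (fun x y => star x y) a)
  map_update_add' {inst} a p x y := by
    rw [Subsingleton.elim inst (instDecidableEqFin (n + 1))]
    simp only [contractNth_update_mul]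
    split_ifs <;> simp
  map_update_smul' {inst} a p c x := by
    rw [Subsingleton.elim inst (instDecidableEqFin (n + 1))]
    simp only [contractNth_update_mul]
    split_ifs <;> simp

/-- `a₁ ▷ f(a₂, …, aₙ₊₁)`. -/
def leftMap {M : Type*} [AddCommGroup M] [Module k M] (lact : A →ₗ[k] M →ₗ[k] M) {n : ℕ}
    (f : MultilinearMap k (fun _ : Fin n => A) M) :
    MultilinearMap k (fun _ : Fin (n + 1) => A) M :=
  LinearMap.uncurryLeft (M := fun _ : Fin (n + 1) => A)
    { toFun := fun a => (lact a).compMultilinearMap f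
      map_add' := fun a b => by ext; simp
      map_smul' := fun c a => by ext; simp }

/-- `f(a₁, …, aₙ) ◁ aₙ₊₁`. -/
def rightMap {M : Type*} [AddCommGroup M] [Module k M] (ract : M →ₗ[k] A →ₗ[k] M) {n : ℕ}
    (f : MultilinearMap k (fun _ : Fin n => A) M) :
    MultilinearMap k (fun _ : Fin (n + 1) => A) M :=
  MultilinearMap.uncurryRight (M := fun _ : Fin (n + 1) => A) (ract.compMultilinearMap f)

/-- The Hochschild differential `δⁿ` for the product `star` on `A` and the left and right actions
`lact`, `ract` of `A` on `M`. -/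
def hochschildDiff {M : Type*} [AddCommGroup M] [Module k M] (star : A →ₗ[k] A →ₗ[k] A)
    (lact : A →ₗ[k] M →ₗ[k] M) (ract : M →ₗ[k] A →ₗ[k] M) {n : ℕ}
    (f : MultilinearMap k (fun _ : Fin n => A) M) :
    MultilinearMap k (fun _ : Fin (n + 1) => A) M :=
  (-1 : k) ^ (n + 1) • leftMap lact f
    + ∑ i : Fin n, (-1 : k) ^ (n - (i : ℕ)) • contractMap star f i
    + rightMap ract f

theorem hochschildDiff_apply {M : Type*} [AddCommGroup M] [Module k M]
    (star : A →ₗ[k] A →ₗ[k] A) (lact : A →ₗ[k] M →ₗ[k] M) (ract : M →ₗ[k] A →ₗ[k] M) {n : ℕ}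
    (f : MultilinearMap k (fun _ : Fin n => A) M) (a : Fin (n + 1) → A) :
    hochschildDiff star lact ract f a =
      (-1 : k) ^ (n + 1) • lact (a 0) (f fun j => a j.succ)
        + ∑ i : Fin n, (-1 : k) ^ (n - (i : ℕ)) •
            f (Fin.contractNth i.castSucc (fun x y => star x y) a)
        + ract (f fun j => a j.castSucc) (a (Fin.last n)) := by
  simp only [hochschildDiff, add_apply, smul_apply, sum_apply]
  rfl

/-- `a ⋆ b = a T(b) + T(a) b + lam ab`. -/
def starProduct (lam : k) (T : A →ₗ[k] A) : A →ₗ[k] A →ₗ[k] A :=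
  LinearMap.mk₂ k (fun a b => a * T b + T a * b + lam • (a * b))
    (fun a a' b => by simp only [map_add, add_mul, smul_add]; abel)
    (fun c a b => by simp only [map_smul, smul_mul_assoc, smul_add, smul_comm lam c])
    (fun a b b' => by simp only [map_add, mul_add, smul_add]; abel)
    (fun c a b => by simp only [map_smul, mul_smul_comm, smul_add, smul_comm lam c])

/-- `a ▷ x = T(a) x - T(ax)`. -/
def leftAction (T : A →ₗ[k] A) : A →ₗ[k] A →ₗ[k] A :=
  LinearMap.mk₂ k (fun a x => T a * x - T (a * x))
    (fun a a' x => by simp only [map_add, add_mul]; abel)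
    (fun c a x => by simp only [map_smul, smul_mul_assoc, smul_sub])
    (fun a x x' => by simp only [map_add, mul_add]; abel)
    (fun c a x => by simp only [map_smul, mul_smul_comm, smul_sub])

/-- `x ◁ a = x T(a) - T(xa)`. -/
def rightAction (T : A →ₗ[k] A) : A →ₗ[k] A →ₗ[k] A :=
  LinearMap.mk₂ k (fun x a => x * T a - T (x * a))
    (fun x x' a => by simp only [map_add, add_mul]; abel)
    (fun c x a => by simp only [map_smul, smul_mul_assoc, smul_sub])
    (fun x a a' => by simp only [map_add, mul_add]; abel)
    (fun c x a => by simp only [map_smul, mul_smul_comm, smul_sub])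

/-- The differential `∂ⁿ : Hom(A^{⊗ n}, A) → Hom(A^{⊗ (n+1)}, A)` of the cochain complex
`C^•_RBO(A)` of `T`: the Hochschild differential of `(A, ⋆)` with coefficients in `A` with
the actions `▷`, `◁`. -/
def rboDiff (lam : k) (T : A →ₗ[k] A) {n : ℕ} (f : MultilinearMap k (fun _ : Fin n => A) A) :
    MultilinearMap k (fun _ : Fin (n + 1) => A) A :=
  hochschildDiff (starProduct lam T) (leftAction T) (rightAction T) f

variable (k A) in
/-- The isomorphism `g ↦ ĝ = g ∘ s^{⊗ n}` from `Hom((sA)^{⊗ n}, A)` to `Hom(A^{⊗ n}, A)`. -/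
def hat (n : ℕ) : HomRBO k A n ≃ₗ[k] MultilinearMap k (fun _ : Fin n => A) A :=
  LinearEquiv.multilinearMapCongrLeft fun _ => susp k A

end RotaBaxterOperators

end RotaBaxter

/-! Since `A` sits in degree `0`, every letter of `sA` has degree `1`, and a cochain can be read as
a function of words in `A` whose Koszul signs reduce to one sign `ε` for each letter crossed. Two
operations on such functions suffice: the cup product, summing `x(Q) y(R)` over `w = QR`, and the
signed insertion `ins ε h`. Insertion is a twisted derivation of the cup product (`insertion_conv`),
and the graded commutator of two insertions is the insertion of their commutator
(`insertion_insertion`), which is the pre-Lie identity of the brace. The product `m` becomes `letter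
* letter`; hence `m{y}` is the graded commutator `adLetter` of `y` with the letter, and `m{x, y}` is
the cup product up to sign.

The formula for `l₃(α, x, y)` then becomes `WordFun.bracket` (`wordRBO_lMixed_two`): the graded cup
commutator corrected by two `gauge` terms, where `gauge y` inserts `m{y}`. Each gauge operator is a
derivation of the cup product, and `adLetter` turns the bracket into the commutator of insertions,
so the gauge operator of a bracket is a commutator of gauge operators. These two facts are what the
Jacobi identity needs (`bracket_jacobi`).

The differential is `λ` times a signed insertion of the product. The letter is the operator `id`,
and in the bracket with it the cup terms cancel and twice the insertion of the product remains
(`bracket_letter`). So `l₁^α` is `-(λ/2)[id, -]`, and its Leibniz rule is the Jacobi identity. Its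
square vanishes because the odd insertion of an associative product has zero graded commutator with
itself and `2` is invertible.

The Maurer–Cartan expression of an operator lives on two-letter words, where it is the Rota–Baxter
identity. In the twisted differential the `λ`-term and the gauge operator of `T` merge into the
insertion of `⋆`; cup products with `T` and the gauge operator of the cochain applied to `T` give
the two halves of the actions `▷` and `◁`. That `∂² = 0` is inherited from the twisted dg Lie
algebra.

On the `L_∞` side, an operation with two leading entries in `𝔠_Alg(A)` and at least one more
vanishes, and no operation accepts entries of `𝔠_RBO(A)` alone. Hence the twisted operations on
`𝔠_RBO(A)` reduce to their term `i = 1`, and `m`, having two slots, kills arities at least `3`. -/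

namespace RotaBaxter

/-! ### Convolution and signed insertion for functions of words -/

section ListCalculus

variable {A N M : Type*}

/-- The convolution `w ↦ ∑_{w = QR} φ (h Q) R`. -/
def conv [Add M] : (List A → N) → (N → List A → M) → List A → M
  | h, φ, [] => φ (h []) []
  | h, φ, a :: w => φ (h []) (a :: w) + conv (fun v => h (a :: v)) φ w

/-- The insertion `w ↦ ∑_{w = PQR} ε ^ |P| f (P, h Q, R)`. -/
def insertion [AddCommGroup M] (ε : ℤˣ) (h : List A → A) : (List A → M) → List A → M
  | f, [] => f [h []]
  | f, a :: w => conv h (fun b v => f (b :: v)) (a :: w)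
      + ε • insertion ε h (fun v => f (a :: v)) w

variable [AddCommGroup M]

theorem conv_add_right (h : List A → N) (φ ψ : N → List A → M) (w : List A) :
    conv h (fun b v => φ b v + ψ b v) w = conv h φ w + conv h ψ w := by
  induction w generalizing h with
  | nil => rfl
  | cons a w ih => simp only [conv, ih]; abel

theorem conv_units_smul_right (u : ℤˣ) (h : List A → N) (φ : N → List A → M) (w : List A) :
    conv h (fun b v => u • φ b v) w = u • conv h φ w := by
  induction w generalizing h with
  | nil => rfl
  | cons a w ih => simp only [conv, ih, smul_add]

variable [AddCommGroup N]

theorem conv_add_left (h h' : List A → N) (φ : N →+ (List A → M)) (w : List A) :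
    conv (fun v => h v + h' v) (fun b => φ b) w
      = conv h (fun b => φ b) w + conv h' (fun b => φ b) w := by
  induction w generalizing h h' with
  | nil => simp [conv]
  | cons a w ih => simp only [conv, ih, map_add, Pi.add_apply]; abel

theorem conv_units_smul_left (u : ℤˣ) (h : List A → N) (φ : N →+ (List A → M)) (w : List A) :
    conv (fun v => u • h v) (fun b => φ b) w = u • conv h (fun b => φ b) w := by
  induction w generalizing h with
  | nil => simp [conv, Units.smul_def]
  | cons a w ih =>
    simp only [conv, ih, smul_add]
    simp [Units.smul_def]

theorem conv_zero_left {φ : N → List A → M} (h0 : ∀ v, φ 0 v = 0) (w : List A) : conv (fun _ => 0) φ w = 0 := by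
  induction w with
  | nil => exact h0 _
  | cons a w ih => rw [conv, h0, ih, add_zero]

/-- Both sides sum over the factorisations `w = QRS` the value of `φ (ψ (g Q) R)` on `S`; additivity
of `φ` lets the inner sum out. -/
theorem conv_assoc (g : List A → A) (ψ : A → List A → N) (φ : N →+ (List A → M)) (w : List A) :
    conv (conv g ψ) (fun b => φ b) w = conv g (fun b => conv (ψ b) (fun c => φ c)) w := by
  induction w generalizing g with
  | nil => rfl
  | cons a w ih =>
    simp only [conv]
    rw [← ih, conv_add_left (fun v => ψ (g []) (a :: v))]
    abel

theorem insertion_add (ε : ℤˣ) (h : List A → A) (f f' : List A → M) (w : List A) :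
    insertion ε h (fun v => f v + f' v) w = insertion ε h f w + insertion ε h f' w := by
  induction w generalizing f f' with
  | nil => rfl
  | cons a w ih =>
    simp only [insertion, ih, smul_add]
    rw [conv_add_right]
    abel

theorem insertion_units_smul (ε u : ℤˣ) (h : List A → A) (f : List A → M) (w : List A) :
    insertion ε h (fun v => u • f v) w = u • insertion ε h f w := by
  induction w generalizing f with
  | nil => rfl
  | cons a w ih =>
    simp only [insertion, ih, smul_add, smul_comm u ε]
    rw [conv_units_smul_right]

theorem insertion_zero (ε : ℤˣ) (h : List A → A) (w : List A) :
    insertion ε h (fun _ => (0 : M)) w = 0 := by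
  have := insertion_add ε h (fun _ => (0 : M)) (fun _ => 0) w
  simpa using this

/-- `insertion ε h` as an additive map. -/
def insertionHom (ε : ℤˣ) (h : List A → A) : (List A → M) →+ (List A → M) where
  toFun := insertion ε h
  map_zero' := funext fun w => insertion_zero ε h w
  map_add' f f' := funext fun w => insertion_add ε h f f' w

/-- Signed Leibniz rule: `g` lands either in the block `Q` fed to `h`, or in what follows it, and in
the second case it has crossed all the letters of `Q`. -/
theorem insertion_conv (ε : ℤˣ) (g : List A → A) (h : List A → N) (φ : N →+ (List A → M))
    (w : List A) :
    insertion ε g (conv h fun b => φ b) w = conv (insertion ε g h) (fun b => φ b) w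
      + conv (fun v => ε ^ v.length • h v) (fun b => insertion ε g (φ b)) w := by
  induction w generalizing h with
  | nil => simp only [insertion, conv, List.length_nil, pow_zero, one_smul]; abel
  | cons a w ih =>
    have e1 : (fun v => conv h (fun b => φ b) (a :: v)) = fun v =>
      φ (h []) (a :: v) + conv (fun v => h (a :: v)) (fun b => φ b) v := rfl
    have e2 : (fun b v => conv h (fun b => φ b) (b :: v)) = fun b v =>
      φ (h []) (b :: v) + conv (fun v => h (b :: v)) (fun b => φ b) v := rfl
    have e3 : conv (insertion ε g h) (fun b => φ b) (a :: w)
        = conv (conv g fun b v => h (b :: v)) (fun b => φ b) (a :: w)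
          + ε • conv (insertion ε g fun v => h (a :: v)) (fun b => φ b) w := by
      simp only [conv, insertion]
      rw [conv_add_left (fun v => h (g [] :: a :: v) + _), conv_units_smul_left]
      abel
    have e4 : conv (fun v => ε ^ v.length • h v) (fun b => insertion ε g (φ b)) (a :: w)
        = insertion ε g (φ (h [])) (a :: w)
          + ε • conv (fun v => ε ^ v.length • h (a :: v)) (fun b => insertion ε g (φ b)) w := by
      simp only [conv, List.length_nil, List.length_cons, pow_zero, one_smul, pow_succ', mul_smul]
      exact congrArg _ (conv_units_smul_left ε (fun v => ε ^ v.length • h (a :: v))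
        ((insertionHom ε g).comp φ) w)
    rw [e3, e4, conv_assoc]
    conv_lhs => rw [insertion, e1, e2, conv_add_right, insertion_add, ih]
    rw [insertion]
    simp only [smul_add]
    abel

/-- Additivity of a function of words in each letter. -/
def IsMultiadditive [Add A] (f : List A → M) : Prop :=
  ∀ (P R : List A) (a b : A), f (P ++ (a + b) :: R) = f (P ++ a :: R) + f (P ++ b :: R)

theorem IsMultiadditive.cons [Add A] {f : List A → M} (hf : IsMultiadditive f) (a : A) :
    IsMultiadditive fun v => f (a :: v) := fun P R b c => hf (a :: P) R b c

/-- A multiadditive function as an additive function of the first letter. -/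
def IsMultiadditive.head [AddCommGroup A] {f : List A → M} (hf : IsMultiadditive f) :
    A →+ (List A → M) :=
  AddMonoidHom.mk' (fun a v => f (a :: v)) fun a b => funext fun v => hf [] v a b

/-- Homogeneity: `f` is a function of words of length `n`. -/
def IsHomogeneous (n : ℕ) (f : List A → M) : Prop := ∀ w, w.length ≠ n → f w = 0

theorem IsHomogeneous.pow_smul {n : ℕ} {f : List A → M} (hf : IsHomogeneous n f) (ε : ℤˣ) :
    (fun v => ε ^ v.length • f v) = fun v => ε ^ n • f v := by
  funext v
  by_cases h : v.length = n
  · rw [h]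
  · simp [hf v h]

theorem isHomogeneous_conv {m n : ℕ}
    {h : List A → N} {φ : N → List A → M} (hh : IsHomogeneous m h) (h0 : ∀ v, φ 0 v = 0)
    (hφ : ∀ b, IsHomogeneous n (φ b)) : IsHomogeneous (m + n) (conv h φ) := by
  intro w hw
  induction w generalizing m h with
  | nil =>
    by_cases hm : m = 0
    · exact hφ _ _ (by simp at hw ⊢; omega)
    · rw [conv, hh [] (by simp; omega), h0]
  | cons a w ih =>
    have e1 : φ (h []) (a :: w) = 0 := by
      by_cases hm : m = 0
      · exact hφ _ _ (by omega)
      · rw [hh [] (by simp; omega), h0]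
    rw [conv, e1, zero_add]
    cases m with
    | zero =>
      have e2 : (fun v => h (a :: v)) = fun _ => 0 := funext fun v => hh _ (by simp)
      rw [e2, conv_zero_left h0]
    | succ m =>
      exact ih (fun v hv => hh _ (by simp; omega)) (by simp at hw; omega)

variable [AddCommGroup A]

/-- The commutator of two insertions. -/
theorem insertion_insertion {p q : ℕ} {g h : List A → A} (hh : IsHomogeneous (p + 1) h)
    (hg : IsHomogeneous (q + 1) g) {ε δ s : ℤˣ} (hδ : δ ^ p = s) (hε : ε ^ q = s)
    {f : List A → M} (hf : IsMultiadditive f) (w : List A) :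
    insertion δ g (insertion ε h f) w = s • insertion ε h (insertion δ g f) w
      + insertion (ε * δ) (fun v => insertion δ g h v - s • insertion ε h g v) f w := by
  -- The relative positions of `g` and `h`: `g` inside an `h` placed first; `h` first and `g` to its
  -- right, after crossing the `p + 1` arguments of `h` (sign `δ ^ (p + 1) = s * δ`); `g` first and
  -- `h` to its right, after crossing the value of `g` (sign `ε`); both beyond the first letter.
  have key : ∀ {p : ℕ} {g h : List A → A} (_ : IsHomogeneous (p + 1) h) {ε δ s : ℤˣ}
      (_ : δ ^ p = s) {f : List A → M} (_ : IsMultiadditive f) (w : List A),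
      insertion δ g (insertion ε h f) w = conv (insertion δ g h) (fun b v => f (b :: v)) w
        + (s * δ) • conv h (fun b => insertion δ g fun v => f (b :: v)) w
        + ε • conv g (fun b => insertion ε h fun v => f (b :: v)) w
        + (match w with
          | [] => 0
          | a :: w => (ε * δ) • insertion δ g (insertion ε h fun v => f (a :: v)) w) := by
    intro p g h hh ε δ s hδ f hf w
    let S : List A → M := fun w => match w with
      | [] => 0
      | a :: w => insertion ε h (fun v => f (a :: v)) w
    have e : insertion ε h f = fun w => conv h (fun b => hf.head b) w + ε • S w := by
      funext w
      cases w with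
      | nil => simp [insertion, conv, S, IsMultiadditive.head]
      | cons a w => rfl
    rw [e, insertion_add, insertion_units_smul, insertion_conv, hh.pow_smul, hδ.symm]
    have e' := conv_units_smul_left (δ ^ (p + 1)) h ((insertionHom δ g).comp hf.head) w
    simp only [AddMonoidHom.comp_apply, insertionHom, AddMonoidHom.coe_mk, ZeroHom.coe_mk] at e'
    rw [e', pow_succ]
    cases w with
    | nil =>
      simp only [insertion, S, add_zero]
      rfl
    | cons a w =>
      simp only [insertion, S, smul_add, mul_smul]
      rw [← add_assoc]
      rfl
  -- The nested term is split into the commutator, which survives, and the nested term of the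
  -- opposite order, which is absorbed by the right-hand side. The two disjoint terms of `key` are
  -- exchanged when the roles of `g` and `h` are.
  have split {f : List A → M} (hf : IsMultiadditive f) (w : List A) :
      conv (insertion δ g h) (fun b v => f (b :: v)) w
        = conv (fun v => insertion δ g h v - s • insertion ε h g v) (fun b v => f (b :: v)) w
          + s • conv (insertion ε h g) (fun b v => f (b :: v)) w := by
    have e := conv_add_left (fun v => insertion δ g h v - s • insertion ε h g v)
      (fun v => s • insertion ε h g v) hf.head w
    simp only [sub_add_cancel, conv_units_smul_left] at e
    exact e
  have hs : s * s = 1 := Int.units_mul_self s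
  induction w generalizing f with
  | nil =>
    rw [key hh hδ hf, key hg hε hf, split hf]
    simp only [insertion, conv, smul_add, smul_smul, ← mul_assoc, hs, one_mul, smul_zero]
    abel
  | cons a w ih =>
    rw [key hh hδ hf, key hg hε hf, split hf, insertion]
    simp only [ih (hf.cons a), smul_add, smul_smul, ← mul_assoc, hs, one_mul, mul_comm δ ε]
    rw [mul_assoc s ε δ, mul_comm s (ε * δ)]
    abel

end ListCalculus
-- The cup product ring of word functions, gauge operators and the Jacobi identity
section WordFunctions

/-- Functions of words in `A` with values in `A`. -/
def WordFun (A : Type*) : Type _ := List A → A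

namespace WordFun

variable {A : Type*}

instance [AddCommGroup A] : AddCommGroup (WordFun A) := inferInstanceAs (AddCommGroup (List A → A))

instance {k : Type*} [Field k] [AddCommGroup A] [Module k A] : Module k (WordFun A) :=
  inferInstanceAs (Module k (List A → A))

@[ext]
theorem ext {x y : WordFun A} (h : ∀ w, x w = y w) : x = y := funext h

section

variable [AddCommGroup A] (x y : WordFun A) (w : List A)

@[simp] theorem zero_apply : (0 : WordFun A) w = 0 := rfl
@[simp] theorem add_apply : (x + y) w = x w + y w := rfl
@[simp] theorem sub_apply : (x - y) w = x w - y w := rfl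
@[simp] theorem neg_apply : (-x) w = -x w := rfl
@[simp] theorem units_smul_apply (u : ℤˣ) : (u • x) w = u • x w := rfl

theorem sum_apply {ι : Type*} (t : Finset ι) (f : ι → WordFun A) :
    (∑ i ∈ t, f i) w = ∑ i ∈ t, f i w := Finset.sum_apply w t f

end

variable [NonUnitalRing A]

/-- The function `b ↦ b · y`. -/
def mulHom (y : WordFun A) : A →+ (List A → A) :=
  AddMonoidHom.mk' (fun b v => b * y v) fun a b => funext fun v => add_mul a b (y v)

/-- The cup product `(x ∪ y)(w) = ∑_{w = QR} x(Q) y(R)`. -/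
instance : Mul (WordFun A) := ⟨fun x y => conv x fun b => mulHom y b⟩

theorem mul_nil (x y : WordFun A) : (x * y) [] = x [] * y [] := rfl

/-- Freezing the first letter. -/
def tail (x : WordFun A) (a : A) : WordFun A := fun v => x (a :: v)

theorem mul_cons (x y : WordFun A) (a : A) (w : List A) :
    (x * y) (a :: w) = x [] * y (a :: w) + (x.tail a * y) w := rfl

theorem conv_const_mul {N : Type*} (b : A) (h : List A → N) (φ : N → List A → A) (w : List A) :
    conv h (fun c v => b * φ c v) w = b * conv h φ w := by
  induction w generalizing h with
  | nil => rfl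
  | cons a w ih => simp only [conv, ih, mul_add]

instance : NonUnitalRing (WordFun A) where
  left_distrib x y z := by
    ext w
    refine Eq.trans ?_ (conv_add_right (x : List A → A) (fun b => mulHom y b)
      (fun b => mulHom z b) w)
    change conv x _ w = conv x _ w
    congr 1
    funext b v
    exact mul_add b (y v) (z v)
  right_distrib x y z := by
    ext w
    exact conv_add_left x y (mulHom z) w
  zero_mul z := by
    ext w
    have h := conv_add_left (fun _ => 0) (fun _ => 0) (mulHom z) w
    simp only [add_zero, left_eq_add] at h
    exact h
  mul_zero x := by
    ext w
    have h := conv_add_right x (fun b => mulHom 0 b) (fun b => mulHom 0 b) w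
    have e : (fun b v => mulHom (0 : WordFun A) b v + mulHom (0 : WordFun A) b v)
      = fun b => mulHom 0 b := by
      funext b v
      change b * 0 + b * 0 = b * 0
      simp
    rw [e, left_eq_add] at h
    exact h
  mul_assoc x y z := by
    ext w
    -- Once the convolution is reassociated and the value `b` of `x` is frozen, only associativity
    -- in `A` remains.
    refine (conv_assoc x (fun b => mulHom y b) (mulHom z) w).trans ?_
    change _ = conv x (fun b v => b * conv y (fun c => mulHom z c) v) w
    congr 1
    funext b v
    refine Eq.trans ?_ (conv_const_mul b y _ v)
    change conv (fun v => b * y v) _ v = _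
    clear w
    generalize (y : List A → A) = y
    induction v generalizing y with
    | nil => exact mul_assoc _ _ _
    | cons a v ih =>
      exact congrArg₂ (· + ·) (mul_assoc _ _ _) (ih fun v => y (a :: v))

/-- The identity of `A`, as a function of words of length `1`. -/
def letter : WordFun A
  | [a] => a
  | _ => 0

/-- The insertion of `h`, with a sign `ε` for each letter to the left of it. -/
def ins (ε : ℤˣ) (h : WordFun A) : WordFun A →+ WordFun A := insertionHom ε h

theorem ins_apply (ε : ℤˣ) (h f : WordFun A) (w : List A) : ins ε h f w = insertion ε h f w := rfl

theorem insertion_const_mul (ε : ℤˣ) (h : List A → A) (b : A) (f : List A → A) (w : List A) :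
    insertion ε h (fun v => b * f v) w = b * insertion ε h f w := by
  induction w generalizing f with
  | nil => rfl
  | cons a w ih =>
    simp only [insertion, ih, mul_add]
    rw [conv_const_mul]
    simp [Units.smul_def, mul_smul_comm]

/-- This is `insertion_conv` for the cup product: to reach `y`, the inserted `h` crosses the `n`
letters consumed by `x`. -/
theorem ins_mul (ε : ℤˣ) (h : WordFun A) {n : ℕ} {x : WordFun A} (hx : IsHomogeneous n x)
    {s : ℤˣ} (hs : ε ^ n = s) (y : WordFun A) :
    ins ε h (x * y) = ins ε h x * y + s • (x * ins ε h y) := by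
  ext w
  have e := insertion_conv ε h x (mulHom y) w
  rw [hx.pow_smul, hs] at e
  refine e.trans (congrArg _ ?_)
  refine Eq.trans ?_ (conv_units_smul_left s x (mulHom (ins ε h y)) w)
  congr 1
  funext b v
  exact insertion_const_mul ε h b y v

/-- An insertion evaluates `f` only on words containing the value of `h`, so the value of `f` at the
empty word never enters. -/
theorem insertion_eq_zero (ε : ℤˣ) (h : List A → A) {f : List A → A}
    (hf : ∀ a v, f (a :: v) = 0) (w : List A) : insertion ε h f w = 0 := by
  have hz (h : List A → A) (w : List A) : conv h (fun b v => f (b :: v)) w = 0 := by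
    induction w generalizing h with
    | nil => exact hf _ _
    | cons a w ih => rw [conv, hf, ih, add_zero]
  cases w with
  | nil => exact hf _ _
  | cons a w =>
    have e : (fun v => f (a :: v)) = fun _ => 0 := funext fun v => hf a v
    rw [insertion, hz, e, insertion_zero, smul_zero, add_zero]

/-- The only slot of `letter` has nothing to its left, so no sign appears. -/
theorem ins_letter (ε : ℤˣ) (h : WordFun A) : ins ε h letter = h := by
  have hc (h : List A → A) (w : List A) : conv h (fun b v => letter (b :: v)) w = h w := by
    induction w generalizing h with
    | nil => rfl
    | cons a w ih => rw [conv, ih]; exact zero_add _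
  ext w
  cases w with
  | nil => rfl
  | cons a w =>
    refine (congrArg₂ (fun b c => b + ε • c) (hc h (a :: w))
      (insertion_eq_zero ε h (f := fun v => letter (a :: v)) (fun _ _ => rfl) w)).trans ?_
    simp

theorem isHomogeneous_letter : IsHomogeneous 1 (letter : WordFun A) := by
  intro w hw
  match w with
  | [] => rfl
  | [a] => simp at hw
  | a :: b :: w => rfl

theorem isHomogeneous_mul {m n : ℕ} {x y : WordFun A} (hx : IsHomogeneous m x)
    (hy : IsHomogeneous n y) : IsHomogeneous (m + n) (x * y) :=
  isHomogeneous_conv hx (fun v => zero_mul (y v)) fun b v hv => by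
    change b * y v = 0
    rw [hy v hv, mul_zero]

/-- Replacing a block of `m` letters by one leaves `n` letters only if `w` has `m + n - 1`.
Multiadditivity is needed to kill the terms where `h` itself vanishes, since they evaluate `f` on a
word containing `0`. -/
theorem insertion_eq_zero_of_length (ε : ℤˣ) {m n : ℕ} {h f : List A → A}
    (hh : IsHomogeneous m h) (hf : IsHomogeneous n f) (hf0 : IsMultiadditive f) {w : List A}
    (hw : w.length + 1 ≠ m + n) : insertion ε h f w = 0 := by
  have h0 {f : List A → A} (hf0 : IsMultiadditive f) (v : List A) : f (0 :: v) = 0 := by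
    simpa using hf0 [] v 0 0
  cases n with
  | zero => exact insertion_eq_zero _ _ (fun _ _ => hf _ (by simp)) _
  | succ n =>
    induction w generalizing n f with
    | nil =>
      by_cases hm : m = 0
      · exact hf _ (by simp at hw ⊢; omega)
      · rw [insertion, hh [] (by simp; omega), h0 hf0]
    | cons a w ih =>
      rw [insertion, isHomogeneous_conv hh (h0 hf0) (n := n)
        (fun b v hv => hf _ (by simp; omega)) _ (by simp at hw ⊢; omega), zero_add]
      cases n with
      | zero =>
        rw [insertion_eq_zero ε h (f := fun v => f (a :: v)) (fun _ _ => hf _ (by simp)),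
          smul_zero]
      | succ n =>
        rw [ih (hf0.cons a) n (fun v hv => hf _ (by simp; omega)) (by simp at hw; omega),
          smul_zero]

/-- The graded commutator of `y` with the letter. -/
def adLetter (ε : ℤˣ) (y : WordFun A) : WordFun A := y * letter - ε • (letter * y)

theorem isHomogeneous_adLetter (ε : ℤˣ) {n : ℕ} {y : WordFun A} (hy : IsHomogeneous n y) :
    IsHomogeneous (n + 1) (adLetter ε y) := by
  intro w hw
  have h1 := isHomogeneous_mul hy isHomogeneous_letter w hw
  have h2 := isHomogeneous_mul isHomogeneous_letter hy w (by omega)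
  rw [adLetter, sub_apply, units_smul_apply, h1, h2, smul_zero, sub_zero]

/-- The infinitesimal action of `y` on functions of words. -/
def gauge (ε : ℤˣ) (y : WordFun A) : WordFun A →+ WordFun A := ins ε (adLetter ε y)

/-- The bracket of the action Lie algebra, with the sign `s = (-1)^{|x||y|}`. -/
def bracket (ε δ s : ℤˣ) (x y : WordFun A) : WordFun A :=
  s • (x * y) - y * x + gauge δ y x - s • gauge ε x y

variable {p q r : ℕ} {ε δ : ℤˣ} {x y z : WordFun A}

theorem isHomogeneous_bracket {s : ℤˣ} (hx : IsHomogeneous p x) (hy : IsHomogeneous q y)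
    (hx' : IsMultiadditive x) (hy' : IsMultiadditive y) :
    IsHomogeneous (p + q) (bracket ε δ s x y) := by
  intro w hw
  have h1 := isHomogeneous_mul hx hy w hw
  have h2 := isHomogeneous_mul hy hx w (by omega)
  have h3 : gauge δ y x w = 0 :=
    insertion_eq_zero_of_length δ (isHomogeneous_adLetter δ hy) hx hx' (by omega)
  have h4 : gauge ε x y w = 0 :=
    insertion_eq_zero_of_length ε (isHomogeneous_adLetter ε hx) hy hy' (by omega)
  simp [bracket, h1, h2, h3, h4]

theorem ins_units_smul (ε u : ℤˣ) (h f : WordFun A) : ins ε h (u • f) = u • ins ε h f :=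
  funext fun w => insertion_units_smul ε u h f w

theorem units_smul_mul (u : ℤˣ) (x y : WordFun A) : (u • x) * y = u • (x * y) := by
  rw [Units.smul_def, Units.smul_def, smul_mul_assoc]

theorem mul_units_smul (u : ℤˣ) (x y : WordFun A) : x * (u • y) = u • (x * y) := by
  rw [Units.smul_def, Units.smul_def, mul_smul_comm]

theorem ins_adLetter (hx : IsHomogeneous p x) {s : ℤˣ} (h2 : δ ^ p = s) :
    ins δ (adLetter δ y) (adLetter ε x) = gauge δ y x * letter + s • (x * adLetter δ y)
      - ε • (adLetter δ y * x + δ • (letter * gauge δ y x)) := by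
  conv_lhs => rw [adLetter.eq_1 ε x, map_sub, ins_units_smul, ins_mul δ _ hx h2,
    ins_mul δ _ isHomogeneous_letter (pow_one δ), ins_letter]
  rfl

/-- The gauge terms are what makes this work: `y ↦ m{y}` becomes a morphism from the bracket to the
graded commutator of insertions. After both sides are expanded by the Leibniz rule, the cup products
cancel by associativity. -/
theorem adLetter_bracket {s : ℤˣ} (hx : IsHomogeneous p x) (hy : IsHomogeneous q y)
    (h1 : ε ^ q = s) (h2 : δ ^ p = s) :
    adLetter (ε * δ) (bracket ε δ s x y)
      = ins δ (adLetter δ y) (adLetter ε x) - s • ins ε (adLetter ε x) (adLetter δ y) := by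
  rw [ins_adLetter hx h2, ins_adLetter hy h1]
  unfold bracket adLetter
  simp only [mul_add, mul_sub, add_mul, sub_mul, smul_add, smul_sub, mul_assoc, units_smul_mul,
    mul_units_smul]
  -- For fixed values `±1` of the signs, the graded identity is an identity in an abelian group.
  rcases Int.units_eq_one_or s with rfl | rfl <;> rcases Int.units_eq_one_or ε with rfl | rfl <;>
    rcases Int.units_eq_one_or δ with rfl | rfl <;>
    simp only [one_smul, Units.neg_smul, mul_one, mul_neg, neg_neg] <;> abel

/-- The gauge operators represent the bracket: `adLetter_bracket` identifies the inserted element,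
and `insertion_insertion` turns its insertion into a commutator. -/
theorem gauge_bracket {s : ℤˣ} (hx : IsHomogeneous p x) (hy : IsHomogeneous q y)
    (h1 : ε ^ q = s) (h2 : δ ^ p = s) (hz : IsMultiadditive z) :
    gauge (ε * δ) (bracket ε δ s x y) z
      = gauge δ y (gauge ε x z) - s • gauge ε x (gauge δ y z) := by
  rw [gauge, adLetter_bracket hx hy h1 h2, eq_sub_iff_add_eq']
  exact funext fun w => (insertion_insertion (isHomogeneous_adLetter ε hx)
    (isHomogeneous_adLetter δ hy) h2 h1 hz w).symm

theorem gauge_mul {s : ℤˣ} (hx : IsHomogeneous p x) (h2 : δ ^ p = s) :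
    gauge δ z (x * y) = gauge δ z x * y + s • (x * gauge δ z y) := ins_mul δ _ hx h2 y

theorem gauge_units_smul (u : ℤˣ) : gauge ε x (u • y) = u • gauge ε x y := ins_units_smul _ _ _ _

theorem bracket_antisymm {s : ℤˣ} : bracket ε δ s x y + s • bracket δ ε s y x = 0 := by
  unfold bracket
  rcases Int.units_eq_one_or s with rfl | rfl <;> simp only [one_smul, Units.neg_smul] <;> abel

/-- Here `ε, δ, η` are the parity signs of `x, y, z`, and `s, t, u` those of the pairs `xy, yz, xz`.
After `gauge_bracket` replaces the gauge operators of brackets and `gauge_mul` distributes the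
others over cup products, all terms cancel by associativity. -/
theorem bracket_jacobi {η s t u : ℤˣ} (hx : IsHomogeneous p x) (hy : IsHomogeneous q y)
    (hz : IsHomogeneous r z) (hx' : IsMultiadditive x) (hy' : IsMultiadditive y)
    (hz' : IsMultiadditive z) (hs1 : ε ^ q = s) (hs2 : δ ^ p = s) (ht1 : δ ^ r = t)
    (ht2 : η ^ q = t) (hu1 : ε ^ r = u) (hu2 : η ^ p = u) :
    bracket (ε * δ) η (u * t) (bracket ε δ s x y) z
      + (s * u) • bracket (δ * η) ε (s * u) (bracket δ η t y z) x
      + (u * t) • bracket (η * ε) δ (t * s) (bracket η ε u z x) y = 0 := by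
  rw [bracket.eq_1 (ε * δ), bracket.eq_1 (δ * η), bracket.eq_1 (η * ε),
    gauge_bracket hx hy hs1 hs2 hz', gauge_bracket hy hz ht1 ht2 hx',
    gauge_bracket hz hx hu2 hu1 hy']
  unfold bracket
  simp only [map_add, map_sub, gauge_units_smul, gauge_mul hx hs2, gauge_mul hx hu2,
    gauge_mul hy hs1, gauge_mul hy ht2, gauge_mul hz hu1, gauge_mul hz ht1, mul_add, mul_sub,
    add_mul, sub_mul, smul_add, smul_sub, mul_assoc, units_smul_mul, mul_units_smul]
  rcases Int.units_eq_one_or s with rfl | rfl <;> rcases Int.units_eq_one_or t with rfl | rfl <;>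
    rcases Int.units_eq_one_or u with rfl | rfl <;>
    simp only [one_smul, Units.neg_smul, mul_one, mul_neg, neg_neg] <;> abel

end WordFun
end WordFunctions
-- Closed formulas for convolution and insertion of homogeneous functions
section Explicit

variable {A M N : Type*} [AddCommGroup M] [AddCommGroup N]

/-- Only the factorisation whose first factor has length `l` contributes. -/
theorem conv_eq_of_isHomogeneous {l : ℕ} {h : List A → N} (hh : IsHomogeneous l h)
    {φ : N → List A → M} (h0 : ∀ v, φ 0 v = 0) {w : List A} (hw : l ≤ w.length) :
    conv h φ w = φ (h (w.take l)) (w.drop l) := by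
  induction w generalizing h l with
  | nil =>
    obtain rfl : l = 0 := by simpa using hw
    rfl
  | cons a w ih =>
    rw [conv]
    cases l with
    | zero =>
      have e : (fun v => h (a :: v)) = fun _ => 0 := funext fun v => hh _ (by simp)
      rw [e, conv_zero_left h0]
      simp
    | succ l =>
      rw [hh [] (by simp), h0, zero_add,
        ih (l := l) (fun v hv => hh _ (by simpa using hv)) (by simpa using hw)]
      simp

theorem insertion_eq_sum [NonUnitalRing A] (ε : ℤˣ) {m l : ℕ} {h f : List A → A}
    (hh : IsHomogeneous l h)
    (hf : IsHomogeneous m f) (hf0 : IsMultiadditive f) {w : List A} (hw : w.length + 1 = m + l) :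
    insertion ε h f w = ∑ i ∈ Finset.range m,
      ε ^ i • f (w.take i ++ h ((w.drop i).take l) :: w.drop (i + l)) := by
  have h0 (v : List A) : f (0 :: v) = 0 := by
    simpa using hf0 [] v 0 0
  induction w generalizing m f with
  | nil =>
    cases m with
    | zero => exact hf _ (by simp)
    | succ m =>
      simp only [List.length_nil] at hw
      obtain rfl : m = 0 := by omega
      obtain rfl : l = 0 := by omega
      simp [insertion]
  | cons a w ih =>
    cases m with
    | zero => exact WordFun.insertion_eq_zero _ _ (fun _ _ => hf _ (by simp)) _
    | succ m =>
      simp only [List.length_cons] at hw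
      rw [insertion, conv_eq_of_isHomogeneous hh h0 (by simp; omega),
        ih (m := m) (fun v hv => hf _ (by simpa using hv)) (hf0.cons a) (by omega) (fun v => by
          simpa using hf0 [a] v 0 0), Finset.sum_range_succ', Finset.smul_sum, add_comm]
      congr 1
      · refine Finset.sum_congr rfl fun i _ => ?_
        rw [smul_smul, ← pow_succ']
        simp [Nat.add_right_comm i 1 l]
      · simp

end Explicit

/-! ### Cochains as functions of words -/

section Evaluation

variable {k : Type*} [Field k] {A : Type*} [AddCommGroup A] [Module k A]

/-- A cochain as a function of words. -/
noncomputable def wordAlg : CAlg k A →ₗ[k] WordFun A where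
  toFun x w := (susp k A).symm (x w.length fun i => susp k A (w.get i))
  map_add' x y := by funext w; simp; rfl
  map_smul' c x := by funext w; simp; rfl

theorem wordAlg_of_length (x : CAlg k A) {w : List A} {n : ℕ} (h : w.length = n) :
    wordAlg x w = (susp k A).symm (x n fun i => susp k A (w.get (i.cast h.symm))) := by
  subst h
  rfl

theorem wordAlg_ofFn (x : CAlg k A) {n : ℕ} (v : Fin n → A) :
    wordAlg x (List.ofFn v) = (susp k A).symm (x n fun i => susp k A (v i)) := by
  rw [wordAlg_of_length x (List.length_ofFn)]
  simp

theorem wordAlg_injective : Function.Injective (wordAlg (k := k) (A := A)) := by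
  intro x y h
  ext n v
  have e := congrFun h (List.ofFn fun i => (susp k A).symm (v i))
  rw [wordAlg_ofFn, wordAlg_ofFn] at e
  simpa using e

/-- Presents the change of one letter as a `Function.update`, the form in which multilinearity can
be applied. -/
theorem wordAlg_letters (P R : List A) (c : A) {n : ℕ}
    (hl : ∀ c : A, (P ++ c :: R).length = n) :
    (fun i => susp k A ((P ++ c :: R).get (Fin.cast (hl c).symm i)))
      = Function.update (fun i => susp k A ((P ++ 0 :: R).get (Fin.cast (hl 0).symm i)))
        ⟨P.length, by have := hl 0; simp at this; omega⟩ (susp k A c) := by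
  funext i
  rw [Function.update_apply]
  split_ifs with hi
  · subst hi
    simp
  · have hi' : (i : ℕ) ≠ P.length := fun h => hi (Fin.ext h)
    simp only [List.get_eq_getElem, Fin.val_cast, List.getElem_append, List.getElem_cons]
    split_ifs <;> first | rfl | omega

theorem isMultiadditive_wordAlg (x : CAlg k A) : IsMultiadditive (wordAlg x : List A → A) := by
  intro P R a b
  have hl (c : A) : (P ++ c :: R).length = P.length + (R.length + 1) := by simp
  rw [wordAlg_of_length x (hl _), wordAlg_of_length x (hl _), wordAlg_of_length x (hl _),
    wordAlg_letters P R _ hl, wordAlg_letters P R a hl, wordAlg_letters P R b hl, map_add,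
    MultilinearMap.map_update_add, map_add]

theorem wordAlg_eq_zero {x : CAlg k A} {n : ℕ} (hx : ∀ l, l ≠ n → x l = 0) :
    IsHomogeneous n (wordAlg x : List A → A) := by
  intro w hw
  rw [wordAlg_of_length x rfl, hx _ hw]
  simp

theorem isHomogeneous_single {n : ℕ} (F : HomAlg k A n) :
    IsHomogeneous n (wordAlg (DFinsupp.single n F) : List A → A) :=
  wordAlg_eq_zero fun l hl => by simp [DFinsupp.single_apply, hl.symm]

theorem wordAlg_single_of_length {n : ℕ} (F : HomAlg k A n) {w : List A} (h : w.length = n) :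
    wordAlg (DFinsupp.single n F) w
      = (susp k A).symm (F fun i => susp k A (w.get (i.cast h.symm))) := by
  rw [wordAlg_of_length _ h, DFinsupp.single_eq_same]

theorem wordAlg_single_ofFn {n : ℕ} (F : HomAlg k A n) (v : Fin n → A) :
    wordAlg (DFinsupp.single n F) (List.ofFn v)
      = (susp k A).symm (F fun i => susp k A (v i)) := by
  rw [wordAlg_ofFn, DFinsupp.single_eq_same]

theorem eq_single_of_isHomogeneous {x : CAlg k A} {n : ℕ}
    (hx : IsHomogeneous n (wordAlg x : List A → A)) : x = DFinsupp.single n (x n) := by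
  apply wordAlg_injective
  ext w
  by_cases h : w.length = n
  · rw [wordAlg_single_of_length _ h, wordAlg_of_length _ h]
  · rw [hx w h, isHomogeneous_single _ w h]

/-- A homogeneous cochain as a function of words. -/
noncomputable def wordHom (c : Σ l : ℕ, HomAlg k A l) : WordFun A :=
  wordAlg (DFinsupp.single c.1 c.2)

theorem wordAlg_plug {m : ℕ} (f : HomAlg k A m) (c : Fin m → Σ l : ℕ, HomAlg k A l) {w : List A}
    (hw : w.length = ∑ j, (c j).1) :
    wordAlg (DFinsupp.single _ (plug f c)) w
      = wordAlg (DFinsupp.single m f) (List.ofFn fun j : Fin m => wordHom (c j)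
          ((w.drop (∑ i : Fin j, (c (i.castLE j.2.le)).1)).take (c j).1)) := by
  rw [wordAlg_single_of_length _ hw, wordAlg_single_ofFn, plug,
    MultilinearMap.domDomCongr_apply, MultilinearMap.compMultilinearMap_apply]
  congr 2
  funext j
  have hj : ((w.drop (∑ i : Fin j, (c (i.castLE j.2.le)).1)).take (c j).1).length = (c j).1 := by
    have : ∑ i : Fin j, (c (i.castLE j.2.le)).1 + (c j).1 ≤ w.length := by
      have h := Finset.sum_le_sum_of_subset (f := fun j => (c j).1)
        (Finset.subset_univ (Finset.univ.map (Fin.castLEEmb (show (j : ℕ) + 1 ≤ m from j.2))))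
      rw [Finset.sum_map, Fin.sum_univ_castSucc] at h
      exact hw ▸ h
    simp; omega
  rw [wordHom, wordAlg_single_of_length _ hj, LinearEquiv.apply_symm_apply]
  congr 1
  funext i
  simp [finSigmaFinEquiv_apply]
  rfl

/-- The family with `h` at the position `i` and the identity elsewhere. -/
noncomputable def slotAt {m : ℕ} (h : Σ l : ℕ, HomAlg k A l) (i j : Fin m) :
    Σ l : ℕ, HomAlg k A l :=
  if j = i then h else
    ⟨1, MultilinearMap.ofSubsingleton k (Susp A) (Susp A) (0 : Fin 1) LinearMap.id⟩

theorem slots_singleton {m : ℕ} (e : Fin 1 ↪o Fin m)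
    (g : Fin 1 → Σ l : ℕ, HomAlg k A l) : slots e g = slotAt (g 0) (e 0) := by
  funext j
  unfold slots slotAt
  split_ifs with hj
  · subst hj
    exact e.injective.extend_apply _ _ _
  · refine Function.extend_apply' _ _ _ ?_
    rintro ⟨a, rfl⟩
    exact hj (by rw [Subsingleton.elim a 0])

theorem slotAt_fst {m : ℕ} (h : Σ l : ℕ, HomAlg k A l) (i j : Fin m) :
    (slotAt h i j).1 = if (j : ℕ) = i then h.1 else 1 := by
  simp only [slotAt, Fin.ext_iff]
  split_ifs <;> rfl

/-- The starting position of block `j` when block `i` has length `l` and all others have length `1`;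
the truncated `j - 1` is harmless because it occurs only for `i < j`. -/
theorem sum_ite_eq_one (i l j : ℕ) :
    ∑ t ∈ Finset.range j, (if t = i then l else 1) = if j ≤ i then j else j - 1 + l := by
  induction j with
  | zero => simp
  | succ j ih =>
    rw [Finset.sum_range_succ, ih]
    split_ifs <;> omega

/-- The choices of one slot. -/
def finOneEmbedding (m : ℕ) : (Fin 1 ↪o Fin m) ≃ Fin m where
  toFun e := e 0
  invFun i := OrderEmbedding.ofStrictMono (fun _ => i) (Subsingleton.strictMono _)
  left_inv e := by
    ext a
    rw [Subsingleton.elim a 0]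
    rfl
  right_inv i := rfl

theorem wordHom_id (a : A) : wordHom (k := k)
    ⟨1, MultilinearMap.ofSubsingleton k (Susp A) (Susp A) (0 : Fin 1) LinearMap.id⟩ [a] = a := by
  rw [wordHom, wordAlg_single_of_length _ (by rfl)]
  simp

theorem wordAlg_units_smul (u : ℤˣ) (x : CAlg k A) : wordAlg (u • x) = u • wordAlg x := by
  rw [Units.smul_def, Units.smul_def, map_zsmul]

/-- Blocks to the left of slot `i` are single letters at their own positions, those to its right are
shifted by `h.1 - 1`. This matches the block description of `plug` with the `take`/`drop`
description of an insertion. -/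
theorem ofFn_slotAt {m : ℕ} (h : Σ l : ℕ, HomAlg k A l) (i : Fin m) {w : List A}
    (hw : w.length + 1 = m + h.1) :
    (List.ofFn fun j : Fin m => wordHom (slotAt h i j)
      ((w.drop (∑ t : Fin j, (slotAt h i (t.castLE j.2.le)).1)).take (slotAt h i j).1))
      = w.take i ++ wordHom h ((w.drop i).take h.1) :: w.drop (i + h.1) := by
  have hi := i.2
  refine List.ext_getElem ?_ fun j h1 h2 => ?_
  · simp; omega
  · simp only [List.length_ofFn] at h1
    have es : ∑ t : Fin j, (slotAt h i (t.castLE h1.le)).1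
        = if j ≤ (i : ℕ) then j else j - 1 + h.1 := by
      simp only [slotAt_fst, Fin.val_castLE]
      rw [Fin.sum_univ_eq_sum_range (fun j => if j = (i : ℕ) then h.1 else 1), sum_ite_eq_one]
    simp only [List.getElem_ofFn, es]
    rcases lt_trichotomy j i with hj | hj | hj
    · have e1 : slotAt h i ⟨j, h1⟩ = ⟨1, MultilinearMap.ofSubsingleton k (Susp A) (Susp A)
        (0 : Fin 1) LinearMap.id⟩ := if_neg fun e => hj.ne (congrArg Fin.val e)
      have e2 : (w.drop j).take 1 = [w[j]] := by
        rw [List.drop_eq_getElem_cons (by omega)]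
        rfl
      rw [e1, if_pos hj.le, e2, wordHom_id, List.getElem_append_left (by simp; omega)]
      simp
    · subst hj
      have e1 : slotAt h i i = h := if_pos rfl
      rw [e1, if_pos le_rfl, List.getElem_append_right (by simp)]
      simp [show min (i : ℕ) w.length = i by omega]
    · have e1 : slotAt h i ⟨j, h1⟩ = ⟨1, MultilinearMap.ofSubsingleton k (Susp A) (Susp A)
        (0 : Fin 1) LinearMap.id⟩ := if_neg fun e => hj.ne' (congrArg Fin.val e)
      have e2 : (w.drop (j - 1 + h.1)).take 1 = [w[j - 1 + h.1]] := by
        rw [List.drop_eq_getElem_cons (by omega)]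
        rfl
      rw [e1, if_neg (by omega), e2, wordHom_id, List.getElem_append_right (by simp; omega)]
      obtain ⟨t, rfl⟩ : ∃ t, j = i + 1 + t := ⟨j - (i + 1), by omega⟩
      simp [show min (i : ℕ) w.length = i by omega, show (i : ℕ) + 1 + t - i = t + 1 by omega]
      congr 1
      omega

end Evaluation

theorem negOnePow_mul_natCast (a : ℤ) (n : ℕ) :
    (a * n).negOnePow = a.negOnePow ^ n := by
  rw [Int.negOnePow_def, Int.negOnePow_def, zpow_mul, zpow_natCast]

/-! ### Braces of homogeneous cochains as insertions and cup products -/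

section Brace

variable {k : Type*} [Field k] {A : Type*} [NonUnitalRing A] [Module k A]

/-- The slots before the chosen one hold identities, so slot `i` has exactly `i` letters on its left
and the Koszul sign is the `i`-th power of the sign of `|h| = 1 - h.1`. The sum over slots is then
`insertion_eq_sum`. -/
theorem wordAlg_braceHom_singleton {m : ℕ} (f : HomAlg k A m) (h : Σ l : ℕ, HomAlg k A l) :
    wordAlg (braceHom f [h]) = WordFun.ins (1 - (h.1 : ℤ)).negOnePow (wordHom h)
      (wordAlg (DFinsupp.single m f)) := by
  have e : braceHom f [h] = ∑ i : Fin m, (1 - (h.1 : ℤ)).negOnePow ^ (i : ℕ) •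
      DFinsupp.single _ (plug f (slotAt h i)) := by
    rw [← (finOneEmbedding m).sum_comp]
    refine Finset.sum_congr rfl fun e _ => ?_
    have es : slots e [h].get = slotAt h (e 0) := slots_singleton e _
    rw [es]
    congr 1
    have ei : ∑ j ∈ Finset.Iio (e 0), ((slotAt h (e 0) j).1 : ℤ) = (e 0 : ℕ) := by
      rw [Finset.sum_congr rfl fun j hj => by
        rw [slotAt_fst, if_neg (by have := Finset.mem_Iio.mp hj; omega)]]
      simp
    change (∑ i : Fin 1, _ : ℤ).negOnePow = _
    rw [Fin.sum_univ_one]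
    change ((1 - (h.1 : ℤ)) * ∑ j ∈ Finset.Iio (e 0), ((slotAt h (e 0) j).1 : ℤ)).negOnePow
      = (1 - (h.1 : ℤ)).negOnePow ^ (e 0 : ℕ)
    rw [ei, negOnePow_mul_natCast]
  ext w
  rw [e, map_sum]
  have hsum (i : Fin m) : ∑ j, (slotAt h i j).1 + 1 = m + h.1 := by
    simp only [slotAt_fst]
    rw [Fin.sum_univ_eq_sum_range (fun j => if j = (i : ℕ) then h.1 else 1), sum_ite_eq_one]
    have := i.2
    split_ifs <;> omega
  have hF := isHomogeneous_single f
  have hF' := isMultiadditive_wordAlg (DFinsupp.single m f)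
  have hh : IsHomogeneous h.1 (wordHom h : List A → A) := isHomogeneous_single h.2
  by_cases hw : w.length + 1 = m + h.1
  · rw [WordFun.ins_apply, insertion_eq_sum _ hh hF hF' hw, ← Fin.sum_univ_eq_sum_range (fun i =>
      (1 - (h.1 : ℤ)).negOnePow ^ i • wordAlg (DFinsupp.single m f)
        (w.take i ++ wordHom h ((w.drop i).take h.1) :: w.drop (i + h.1)))]
    rw [WordFun.sum_apply]
    refine Finset.sum_congr rfl fun i _ => ?_
    rw [wordAlg_units_smul, WordFun.units_smul_apply,
      wordAlg_plug _ _ (by have := hsum i; omega), ofFn_slotAt h i hw]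
  · rw [WordFun.ins_apply, WordFun.insertion_eq_zero_of_length _ hh hF hF' (by omega),
      WordFun.sum_apply]
    refine Finset.sum_eq_zero fun i _ => ?_
    rw [wordAlg_units_smul, WordFun.units_smul_apply,
      isHomogeneous_single _ w (by have := hsum i; omega), smul_zero]

theorem wordAlg_mulCochain [IsScalarTower k A A] [SMulCommClass k A A] (a b : A) :
    wordAlg (DFinsupp.single 2 (mulCochain k A)) [a, b] = a * b := by
  rw [wordAlg_single_of_length _ (by rfl)]
  simp [mulCochain]

theorem wordAlg_mulCochain_eq [IsScalarTower k A A] [SMulCommClass k A A] :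
    wordAlg (DFinsupp.single 2 (mulCochain k A)) = WordFun.letter * WordFun.letter := by
  ext w
  by_cases hw : w.length = 2
  · match w, hw with
    | [a, b], _ =>
      rw [wordAlg_mulCochain]
      simp [WordFun.mul_cons, WordFun.mul_nil, WordFun.letter, WordFun.tail]
  · rw [isHomogeneous_single _ w hw, WordFun.isHomogeneous_mul WordFun.isHomogeneous_letter
      WordFun.isHomogeneous_letter w hw]

theorem fin_two_embedding (e : Fin 2 ↪o Fin 2) (i : Fin 2) : e i = i := by
  have h : e 0 < e 1 := e.lt_iff_lt.mpr (by decide)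
  fin_cases i <;> simp only [Fin.zero_eta, Fin.mk_one] <;> omega

theorem wordAlg_braceHom_mulCochain [IsScalarTower k A A] [SMulCommClass k A A]
    (x y : Σ l : ℕ, HomAlg k A l) :
    wordAlg (braceHom (mulCochain k A) [x, y])
      = ((1 - (y.1 : ℤ)) * x.1).negOnePow • (wordHom x * wordHom y) := by
  have e : braceHom (mulCochain k A) [x, y] = ((1 - (y.1 : ℤ)) * x.1).negOnePow •
      DFinsupp.single _ (plug (mulCochain k A) ![x, y]) := by
    -- The only increasing choice of two slots among two is the identity.
    refine (Finset.sum_eq_single (RelEmbedding.refl (α := Fin 2) (· ≤ ·)) (fun e _ he => ?_)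
      (fun h => absurd (Finset.mem_univ _) h)).trans ?_
    · refine absurd ?_ he
      ext i
      exact congrArg Fin.val (fin_two_embedding e i)
    · have es : slots (RelEmbedding.refl (α := Fin 2) (· ≤ ·)) [x, y].get = ![x, y] := by
        funext j
        refine ((RelEmbedding.refl (α := Fin 2) (· ≤ ·)).injective.extend_apply _ _ j).trans ?_
        fin_cases j <;> rfl
      rw [es]
      congr 1
      change (∑ i : Fin 2, _ : ℤ).negOnePow = _
      rw [Fin.sum_univ_two]
      change ((1 - (x.1 : ℤ)) * ∑ j ∈ Finset.Iio (0 : Fin 2), ((![x, y] j).1 : ℤ)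
        + (1 - (y.1 : ℤ)) * ∑ j ∈ Finset.Iio (1 : Fin 2), ((![x, y] j).1 : ℤ)).negOnePow = _
      rw [show Finset.Iio (0 : Fin 2) = ∅ from rfl, show Finset.Iio (1 : Fin 2) = {0} from rfl]
      simp
  ext w
  rw [e, wordAlg_units_smul, WordFun.units_smul_apply, WordFun.units_smul_apply]
  congr 1
  have hx : IsHomogeneous x.1 (wordHom x : List A → A) := isHomogeneous_single x.2
  have hy : IsHomogeneous y.1 (wordHom y : List A → A) := isHomogeneous_single y.2
  have hsum : ∑ j, (![x, y] j).1 = x.1 + y.1 := by simp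
  by_cases hw : w.length = x.1 + y.1
  · rw [wordAlg_plug _ _ (hw.trans hsum.symm)]
    refine Eq.trans ?_ (conv_eq_of_isHomogeneous hx (φ := fun b => WordFun.mulHom (wordHom y) b)
      (fun v => zero_mul _) (by omega)).symm
    have e2 : (w.drop x.1).take y.1 = w.drop x.1 := List.take_of_length_le (by simp; omega)
    simp only [List.ofFn_succ, List.ofFn_zero]
    refine (wordAlg_mulCochain _ _).trans ?_
    simp [e2]
    rfl
  · rw [isHomogeneous_single _ w (by rwa [hsum]), WordFun.isHomogeneous_mul hx hy w hw]

end Brace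
-- Braces on the direct sum, and braces with the product
section Brace

variable {k : Type*} [Field k] {A : Type*} [NonUnitalRing A] [Module k A]

theorem braceHom_zero {m : ℕ} (gs : List (Σ l : ℕ, HomAlg k A l)) :
    braceHom (0 : HomAlg k A m) gs = 0 := by
  refine Finset.sum_eq_zero fun e _ => ?_
  have h : plug (0 : HomAlg k A m) (slots e gs.get) = 0 := by
    ext v
    rfl
  rw [h, DFinsupp.single_zero, smul_zero]

theorem extendAlg_zero {M : Type*} [AddCommMonoid M] (gs : List (CAlg k A)) :
    extendAlg (fun _ => (0 : M)) gs = 0 := by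
  induction gs with
  | nil => rfl
  | cons x xs ih => simp [extendAlg, ih, DFinsupp.sum]

/-- The hypothesis covers `g = 0`, where the support is empty and the sum does not see the value of
`phi` at the zero component. -/
theorem extendAlg_single_cons {M : Type*} [AddCommMonoid M]
    (phi : List (Σ l : ℕ, HomAlg k A l) → M) {l : ℕ} (g : HomAlg k A l) (xs : List (CAlg k A))
    (h : extendAlg (fun ys => phi (⟨l, 0⟩ :: ys)) xs = 0) :
    extendAlg phi (DFinsupp.single l g :: xs) = extendAlg (fun ys => phi (⟨l, g⟩ :: ys)) xs := by
  classical
  exact DFinsupp.sum_single_index h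

theorem brace_single {m : ℕ} (f : HomAlg k A m) (gs : List (CAlg k A)) :
    brace (DFinsupp.single m f) gs = extendAlg (braceHom f) gs := by
  classical
  refine DFinsupp.sum_single_index ?_
  rw [show braceHom (0 : HomAlg k A m) = fun _ => 0 from funext braceHom_zero, extendAlg_zero]

theorem wordHom_zero (l : ℕ) : wordHom (⟨l, 0⟩ : Σ l : ℕ, HomAlg k A l) = 0 := by
  rw [wordHom, DFinsupp.single_zero, map_zero]

theorem ins_zero_left (ε : ℤˣ) {f : WordFun A} (hf : IsMultiadditive (f : List A → A)) :
    WordFun.ins ε 0 f = 0 := by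
  have h0 {f : List A → A} (hf : IsMultiadditive f) (v : List A) : f (0 :: v) = 0 := by
    simpa using hf [] v 0 0
  ext w
  change insertion ε (fun _ => 0) f w = 0
  induction w generalizing f with
  | nil => exact h0 hf _
  | cons a w ih =>
    refine (congrArg₂ (· + ε • ·) (conv_zero_left (h0 hf) (a :: w)) (ih (hf.cons a))).trans ?_
    simp

theorem brace_single_single {m n : ℕ} (f : HomAlg k A m) (g : HomAlg k A n) :
    brace (DFinsupp.single m f) [DFinsupp.single n g] = braceHom f [⟨n, g⟩] := by
  rw [brace_single]
  refine extendAlg_single_cons _ _ _ (wordAlg_injective ?_)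
  change wordAlg (braceHom f [⟨n, 0⟩]) = _
  rw [wordAlg_braceHom_singleton, wordHom_zero, map_zero,
    ins_zero_left _ (isMultiadditive_wordAlg _)]

theorem wordAlg_brace_singleton {m n : ℕ} (f : HomAlg k A m) {y : CAlg k A}
    (hy : IsHomogeneous n (wordAlg y : List A → A)) :
    wordAlg (brace (DFinsupp.single m f) [y])
      = WordFun.ins (1 - (n : ℤ)).negOnePow (wordAlg y) (wordAlg (DFinsupp.single m f)) := by
  rw [eq_single_of_isHomogeneous hy, brace_single_single, wordAlg_braceHom_singleton]
  rfl

theorem brace_single_nil {m : ℕ} (f : HomAlg k A m) :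
    brace (DFinsupp.single m f) [] = DFinsupp.single m f := by
  have e : braceHom f [] = DFinsupp.single _ (plug f fun _ =>
      ⟨1, MultilinearMap.ofSubsingleton k (Susp A) (Susp A) (0 : Fin 1) LinearMap.id⟩) := by
    have : Unique (Fin 0 ↪o Fin m) :=
      ⟨⟨OrderEmbedding.ofIsEmpty⟩, fun e => by ext i; exact i.elim0⟩
    refine (Fintype.sum_unique (ι := Fin 0 ↪o Fin m) _).trans ?_
    have es : slots (default : Fin 0 ↪o Fin m) ([] : List (Σ l : ℕ, HomAlg k A l)).get = fun _ =>
        ⟨1, MultilinearMap.ofSubsingleton k (Susp A) (Susp A) (0 : Fin 1) LinearMap.id⟩ :=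
      funext fun j => Function.extend_apply' _ _ _ (by rintro ⟨a, -⟩; exact a.elim0)
    rw [es]
    exact one_smul _ _
  rw [brace_single]
  change braceHom f [] = _
  rw [e]
  apply wordAlg_injective
  ext w
  by_cases hw : w.length = m
  · rw [wordAlg_plug _ _ (by simp [hw])]
    refine congrArg (wordAlg (DFinsupp.single m f)) ?_
    refine List.ext_getElem (by simp [hw]) fun j h1 h2 => ?_
    have e2 : (w.drop j).take 1 = [w[j]] := by
      rw [List.drop_eq_getElem_cons h2]
      rfl
    simp [e2, wordHom_id]
  · have hw' : w.length ≠ ∑ _j : Fin m, 1 := by simpa using hw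
    rw [isHomogeneous_single _ w hw]
    exact isHomogeneous_single _ w hw'

variable [IsScalarTower k A A] [SMulCommClass k A A]

theorem brace_mulCochain_pair (x y : Σ l : ℕ, HomAlg k A l) :
    brace (DFinsupp.single 2 (mulCochain k A)) [DFinsupp.single x.1 x.2, DFinsupp.single y.1 y.2]
      = braceHom (mulCochain k A) [x, y] := by
  rw [brace_single]
  have h1 (x : Σ l : ℕ, HomAlg k A l) (l : ℕ) : braceHom (mulCochain k A) [x, ⟨l, 0⟩] = 0 :=
    wordAlg_injective (by
      rw [wordAlg_braceHom_mulCochain, wordHom_zero, mul_zero, smul_zero, map_zero])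
  have h2 (l : ℕ) : braceHom (mulCochain k A) [⟨l, 0⟩, y] = 0 :=
    wordAlg_injective (by
      rw [wordAlg_braceHom_mulCochain, wordHom_zero, zero_mul, smul_zero, map_zero])
  have h3 (x : Σ l : ℕ, HomAlg k A l) :
      extendAlg (fun ys => braceHom (mulCochain k A) (x :: ys)) [DFinsupp.single y.1 y.2]
        = braceHom (mulCochain k A) [x, y] := extendAlg_single_cons _ _ _ (h1 x _)
  refine (extendAlg_single_cons _ _ _ ?_).trans (h3 x)
  exact (h3 ⟨x.1, 0⟩).trans (h2 _)

/-- The bracket `m{y}` is the graded commutator with the letter. -/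
theorem wordAlg_brace_mulCochain {n : ℕ} {y : CAlg k A}
    (hy : IsHomogeneous n (wordAlg y : List A → A)) :
    wordAlg (brace (DFinsupp.single 2 (mulCochain k A)) [y])
      = WordFun.adLetter (n : ℤ).negOnePow (wordAlg y) := by
  rw [wordAlg_brace_singleton _ hy, wordAlg_mulCochain_eq,
    WordFun.ins_mul _ _ WordFun.isHomogeneous_letter (pow_one _), WordFun.ins_letter,
    WordFun.adLetter, Int.negOnePow_sub, Int.negOnePow_one, neg_one_mul, Units.neg_smul,
    sub_eq_add_neg]

end Brace

/-! ### The mixed operations evaluated at the product -/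

section Operations

variable {k : Type*} [Field k] {A : Type*} [NonUnitalRing A] [Module k A]

/-- An element of `𝔠_RBO(A)` as a function of words. -/
noncomputable def wordRBO : CRBO k A →ₗ[k] WordFun A :=
  wordAlg ∘ₗ (suspCochain k A).toLinearMap

theorem wordRBO_apply (x : CRBO k A) (w : List A) :
    wordRBO x w = x w.length fun i => susp k A (w.get i) := rfl

theorem wordRBO_injective : Function.Injective (wordRBO (k := k) (A := A)) :=
  fun _ _ h => (suspCochain k A).injective (wordAlg_injective h)

theorem wordRBO_suspCochain_symm (x : CAlg k A) :
    wordRBO ((suspCochain k A).symm x) = wordAlg x := by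
  rw [wordRBO, LinearMap.comp_apply, LinearEquiv.coe_coe, LinearEquiv.apply_symm_apply]

/-- A homogeneous element of `𝔠_RBO(A)` as a function of words. -/
noncomputable def wordHomRBO (g : Σ l : ℕ, HomRBO k A l) : WordFun A :=
  wordRBO (DFinsupp.single g.1 g.2)

theorem suspHom_eq (g : Σ l : ℕ, HomRBO k A l) : suspHom g
    = DFinsupp.single g.1 (LinearEquiv.multilinearMapCongrRight k (susp k A) g.2) :=
  DFinsupp.mapRange_single (hf := fun _ => map_zero _)

theorem wordAlg_suspHom (g : Σ l : ℕ, HomRBO k A l) : wordAlg (suspHom g) = wordHomRBO g := rfl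

theorem isMultiadditive_wordRBO (x : CRBO k A) : IsMultiadditive (wordRBO x : List A → A) :=
  isMultiadditive_wordAlg _

theorem isHomogeneous_wordHomRBO (g : Σ l : ℕ, HomRBO k A l) :
    IsHomogeneous g.1 (wordHomRBO g : List A → A) := by
  rw [← wordAlg_suspHom, suspHom_eq]
  exact isHomogeneous_single _

theorem wordRBO_units_smul (u : ℤˣ) (x : CRBO k A) : wordRBO (u • x) = u • wordRBO x := by
  rw [Units.smul_def, Units.smul_def, map_zsmul]

theorem negOnePow_natCast (n : ℕ) : (n : ℤ).negOnePow = (-1) ^ n := zpow_natCast _ n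

theorem lMixed_eq_zero (lam : k) {p q : ℕ} (hq : p < q + 1) (h : HomAlg k A p)
    (g : Fin (q + 1) → Σ l : ℕ, HomRBO k A l) : lMixed lam h g = 0 := by
  refine Finset.sum_eq_zero fun σ _ => ?_
  simp only [hq.ne', hq.not_gt, if_false]

variable [IsScalarTower k A A] [SMulCommClass k A A]

theorem wordAlg_brace_mulCochain_suspHom (y : Σ l : ℕ, HomRBO k A l) :
    wordAlg (brace (DFinsupp.single 2 (mulCochain k A)) [suspHom y])
      = WordFun.adLetter (y.1 : ℤ).negOnePow (wordHomRBO y) :=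
  wordAlg_brace_mulCochain (isHomogeneous_wordHomRBO y)

theorem wordAlg_brace_suspHom_pair (x y : Σ l : ℕ, HomRBO k A l) :
    wordAlg (brace (DFinsupp.single 2 (mulCochain k A)) [suspHom x, suspHom y])
      = ((1 - (y.1 : ℤ)) * x.1).negOnePow • (wordHomRBO x * wordHomRBO y) := by
  have h (z : Σ l : ℕ, HomRBO k A l) : wordHom
      ⟨z.1, LinearEquiv.multilinearMapCongrRight k (susp k A) z.2⟩ = wordHomRBO z :=
    congrArg (fun t => wordAlg t) (suspHom_eq z).symm
  have e := wordAlg_braceHom_mulCochain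
    ⟨x.1, LinearEquiv.multilinearMapCongrRight k (susp k A) x.2⟩
    ⟨y.1, LinearEquiv.multilinearMapCongrRight k (susp k A) y.2⟩
  rw [h, h, ← brace_mulCochain_pair] at e
  rw [suspHom_eq x, suspHom_eq y]
  exact e

theorem wordAlg_brace_suspHom_nested (x y : Σ l : ℕ, HomRBO k A l) :
    wordAlg (brace (suspHom x) [brace (DFinsupp.single 2 (mulCochain k A)) [suspHom y]])
      = WordFun.gauge (y.1 : ℤ).negOnePow (wordHomRBO y) (wordHomRBO x) := by
  have hy : IsHomogeneous (y.1 + 1)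
      (wordAlg (brace (DFinsupp.single 2 (mulCochain k A)) [suspHom y]) : List A → A) := by
    rw [wordAlg_brace_mulCochain_suspHom]
    exact WordFun.isHomogeneous_adLetter _ (isHomogeneous_wordHomRBO y)
  rw [suspHom_eq x, wordAlg_brace_singleton _ hy, ← suspHom_eq, wordAlg_suspHom,
    wordAlg_brace_mulCochain_suspHom]
  -- The element `m{sy}` takes `y.1 + 1` arguments, hence has degree `-y.1`; this is why the gauge
  -- operator carries the parity sign of `y` itself.
  have e : (1 - ((y.1 + 1 : ℕ) : ℤ)).negOnePow = (y.1 : ℤ).negOnePow := by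
    rw [← Int.negOnePow_neg]
    congr 1
    push_cast
    ring
  rw [e]
  rfl

theorem koszulChi_one {n : ℕ} (d : Fin n → ℤ) : koszulChi 1 d = 1 := by
  rw [koszulChi, Equiv.Perm.sign_one, one_mul]
  refine Finset.prod_eq_one fun i _ => Finset.prod_eq_one fun j _ => if_neg ?_
  rintro ⟨h1, h2⟩
  exact h1.asymm h2

theorem koszulChi_swap (d : Fin 2 → ℤ) :
    koszulChi (Equiv.swap 0 1) d = -(d 0 * d 1).negOnePow := by
  simp [koszulChi, Fin.prod_univ_two, mul_comm]

/-- One argument for the two slots of `m`: only the nested term occurs, with `λ ^ (2 - 1)` and the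
empty inner brace `m{} = m`. -/
theorem wordRBO_lMixed_one (lam : k) (g : Fin (0 + 1) → Σ l : ℕ, HomRBO k A l) :
    wordRBO (lMixed lam (mulCochain k A) g) = -(((g 0).1 : ℤ).negOnePow • lam •
      WordFun.ins (-1) (WordFun.letter * WordFun.letter) (wordHomRBO (g 0))) := by
  have hu : (Finset.univ : Finset (Equiv.Perm (Fin (0 + 1)))) = {1} := by decide
  have e : wordAlg (brace (suspHom (g 0)) [brace (DFinsupp.single 2 (mulCochain k A)) []])
      = WordFun.ins (-1) (WordFun.letter * WordFun.letter) (wordHomRBO (g 0)) := by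
    rw [brace_single_nil, suspHom_eq, wordAlg_brace_singleton _ (isHomogeneous_single _),
      ← suspHom_eq, wordAlg_suspHom, wordAlg_mulCochain_eq]
    rfl
  unfold lMixed
  rw [hu, Finset.sum_singleton]
  simp [koszulChi_one, wordRBO_suspCochain_symm, e, Int.negOnePow_add]

/-- Both slots of `m` are filled, so no power of `λ` appears. Each of the two permutations
contributes one cup product, from `m{sx, sy}`, and one gauge term, from the nested brace; this is
the origin of `WordFun.bracket`. -/
theorem wordRBO_lMixed_two (lam : k) (g : Fin (1 + 1) → Σ l : ℕ, HomRBO k A l) :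
    wordRBO (lMixed lam (mulCochain k A) g) =
      WordFun.bracket ((g 0).1 : ℤ).negOnePow ((g 1).1 : ℤ).negOnePow
        ((g 0).1 * (g 1).1 : ℤ).negOnePow (wordHomRBO (g 0)) (wordHomRBO (g 1)) := by
  have hu : (Finset.univ : Finset (Equiv.Perm (Fin (1 + 1)))) = {1, Equiv.swap 0 1} := by decide
  have hI : (Finset.Iic 0 : Finset (Fin (1 + 1))) = {0} := rfl
  have h2 : (-2 : ℤ).negOnePow = 1 := rfl
  unfold lMixed
  rw [hu, Finset.sum_pair (by decide)]
  simp [koszulChi_one, koszulChi_swap, wordRBO_suspCochain_symm,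
    Int.negOnePow_add, wordAlg_brace_suspHom_pair, wordAlg_brace_suspHom_nested, hI, h2,
    sub_mul, Int.negOnePow_sub, mul_comm ((g 1).1 : ℤ), WordFun.bracket]
  generalize ((g 0).1 : ℤ).negOnePow = a
  generalize ((g 1).1 : ℤ).negOnePow = b
  generalize (((g 0).1 : ℤ) * (g 1).1).negOnePow = s
  rcases Int.units_eq_one_or s with rfl | rfl <;> rcases Int.units_eq_one_or a with rfl | rfl <;>
    rcases Int.units_eq_one_or b with rfl | rfl <;>
    simp only [one_smul, Units.neg_smul, mul_one, mul_neg, neg_neg] <;> abel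

end Operations
-- Linearity of convolution and insertion
section Scalars

variable {k : Type*} [Field k] {A N M : Type*} [AddCommGroup M] [Module k M]

theorem conv_smul_right (c : k) (h : List A → N) (φ : N → List A → M) (w : List A) :
    conv h (fun b v => c • φ b v) w = c • conv h φ w := by
  induction w generalizing h with
  | nil => rfl
  | cons a w ih => simp only [conv, ih, smul_add]

theorem insertion_smul (c : k) (ε : ℤˣ) (h : List A → A) (f : List A → M) (w : List A) :
    insertion ε h (fun v => c • f v) w = c • insertion ε h f w := by
  induction w generalizing f with
  | nil => rfl
  | cons a w ih =>
    simp only [insertion, ih, smul_add, smul_comm c ε]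
    congr 1
    exact conv_smul_right c h _ (a :: w)

variable [AddCommGroup N] [Module k N]

theorem conv_smul_left (c : k) (h : List A → N) {φ : N → List A → M}
    (hφ : ∀ b v, φ (c • b) v = c • φ b v) (w : List A) :
    conv (fun v => c • h v) φ w = c • conv h φ w := by
  induction w generalizing h with
  | nil => exact hφ _ _
  | cons a w ih => simp only [conv, ih, hφ, smul_add]

theorem insertion_smul_left [AddCommGroup A] [Module k A] (c : k) (ε : ℤˣ) (h : List A → A)
    {f : List A → M} (hf : ∀ P R a, f (P ++ (c • a) :: R) = c • f (P ++ a :: R)) (w : List A) :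
    insertion ε (fun v => c • h v) f w = c • insertion ε h f w := by
  induction w generalizing f with
  | nil => exact hf [] [] _
  | cons a w ih =>
    simp only [insertion, smul_add, smul_comm c ε]
    rw [conv_smul_left c h (fun b v => hf [] v b), ih fun P R b => hf (a :: P) R b]

theorem insertion_add_left [AddCommGroup A] (ε : ℤˣ) (h h' : List A → A)
    {f : List A → M} (hf : IsMultiadditive f) (w : List A) :
    insertion ε (fun v => h v + h' v) f w = insertion ε h f w + insertion ε h' f w := by
  induction w generalizing f with
  | nil => exact hf [] [] _ _
  | cons a w ih =>
    simp only [insertion, smul_add, ih (hf.cons a)]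
    have e := conv_add_left h h' hf.head (a :: w)
    simp only [IsMultiadditive.head, AddMonoidHom.mk'_apply] at e
    rw [e]
    abel

end Scalars

/-! ### The bracket as a bilinear map on the direct sum -/

section Bilinear

variable {k : Type*} [Field k] {A : Type*} [NonUnitalRing A] [Module k A]

theorem wordAlg_smul_letter (x : CAlg k A) (c : k) (P R : List A) (a : A) :
    wordAlg x (P ++ (c • a) :: R) = c • wordAlg x (P ++ a :: R) := by
  have hl (b : A) : (P ++ b :: R).length = P.length + (R.length + 1) := by simp
  rw [wordAlg_of_length x (hl _), wordAlg_of_length x (hl _), wordAlg_letters P R (c • a) hl,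
    wordAlg_letters P R a hl, map_smul, MultilinearMap.map_update_smul, map_smul]

namespace WordFun

theorem ins_smul (c : k) (ε : ℤˣ) (h f : WordFun A) : ins ε h (c • f) = c • ins ε h f :=
  funext fun w => insertion_smul c ε h f w

theorem gauge_smul (c : k) (ε : ℤˣ) (h f : WordFun A) :
    gauge ε h (c • f) = c • gauge ε h f := ins_smul _ _ _ _

/-- Homogeneity in the inserted element requires the receiving function to be multilinear, hence to
come from a cochain. -/
theorem ins_smul_left (c : k) (ε : ℤˣ) (h : WordFun A) (x : CRBO k A) :
    ins ε (c • h) (wordRBO x) = c • ins ε h (wordRBO x) :=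
  funext fun w => insertion_smul_left c ε h (wordAlg_smul_letter (suspCochain k A x) c) w

variable [IsScalarTower k A A] [SMulCommClass k A A]

instance : IsScalarTower k (WordFun A) (WordFun A) where
  smul_assoc c x y := by
    ext w
    exact conv_smul_left c x (fun b v => smul_mul_assoc c b (y v)) w

instance : SMulCommClass k (WordFun A) (WordFun A) where
  smul_comm c x y := by
    ext w
    refine (conv_smul_right c x (fun b => mulHom y b) w).symm.trans ?_
    change conv x _ w = conv x _ w
    congr 1
    funext b v
    exact (mul_smul_comm c b (y v)).symm

theorem ins_add_left (ε : ℤˣ) (h h' : WordFun A) {f : WordFun A}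
    (hf : IsMultiadditive (f : List A → A)) : ins ε (h + h') f = ins ε h f + ins ε h' f :=
  funext fun w => insertion_add_left ε h h' hf w

theorem gauge_add_left (ε : ℤˣ) (h h' : WordFun A) {f : WordFun A}
    (hf : IsMultiadditive (f : List A → A)) :
    gauge ε (h + h') f = gauge ε h f + gauge ε h' f := by
  rw [gauge, gauge, gauge, ← ins_add_left _ _ _ hf]
  congr 2
  simp only [adLetter, add_mul, mul_add, smul_add]
  abel

theorem gauge_smul_left (c : k) (ε : ℤˣ) (h : WordFun A) (x : CRBO k A) :
    gauge ε (c • h) (wordRBO x) = c • gauge ε h (wordRBO x) := by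
  rw [gauge, gauge, ← ins_smul_left]
  congr 2
  simp only [adLetter, smul_mul_assoc, mul_smul_comm, smul_sub, smul_comm c ε]

theorem bracket_add_left (ε δ s : ℤˣ) {x x' y : WordFun A}
    (hy : IsMultiadditive (y : List A → A)) :
    bracket ε δ s (x + x') y = bracket ε δ s x y + bracket ε δ s x' y := by
  simp only [bracket, add_mul, mul_add, map_add, gauge_add_left ε x x' hy, smul_add]
  abel

theorem bracket_add_right (ε δ s : ℤˣ) {x y y' : WordFun A}
    (hx : IsMultiadditive (x : List A → A)) :
    bracket ε δ s x (y + y') = bracket ε δ s x y + bracket ε δ s x y' := by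
  simp only [bracket, add_mul, mul_add, map_add, gauge_add_left δ y y' hx, smul_add]
  abel

theorem bracket_smul_left (c : k) (ε δ s : ℤˣ) (x : WordFun A) (y : CRBO k A) :
    bracket ε δ s (c • x) (wordRBO y) = c • bracket ε δ s x (wordRBO y) := by
  simp only [bracket, smul_mul_assoc, mul_smul_comm, gauge_smul, gauge_smul_left, smul_add,
    smul_sub, smul_comm c s]

theorem bracket_smul_right (c : k) (ε δ s : ℤˣ) (x : CRBO k A) (y : WordFun A) :
    bracket ε δ s (wordRBO x) (c • y) = c • bracket ε δ s (wordRBO x) y := by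
  simp only [bracket, smul_mul_assoc, mul_smul_comm, gauge_smul, gauge_smul_left, smul_add,
    smul_sub, smul_comm c s]

end WordFun

open scoped Classical in
theorem map_eq_sum_single {M : Type*} [AddCommGroup M] [Module k M] (F : CRBO k A →ₗ[k] M)
    (x : CRBO k A) : F x = x.sum fun n g => F (DFinsupp.single n g) := by
  conv_lhs => rw [← DFinsupp.sum_single (f := x)]
  exact map_sum F _ _

variable [IsScalarTower k A A] [SMulCommClass k A A]

theorem wordRBO_lMixed_pair (lam : k) {m n : ℕ} (x : HomRBO k A m) (y : HomRBO k A n) :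
    wordRBO (lMixed lam (mulCochain k A) (q := 1)
        ([⟨m, x⟩, ⟨n, y⟩] : List (Σ l : ℕ, HomRBO k A l)).get)
      = WordFun.bracket (m : ℤ).negOnePow (n : ℤ).negOnePow (m * n : ℤ).negOnePow
        (wordRBO (DFinsupp.single m x)) (wordRBO (DFinsupp.single n y)) :=
  wordRBO_lMixed_two lam _

/-- The operation `l₂^α` on homogeneous elements of `𝔠_RBO(A)`. -/
noncomputable def bracketHom (lam : k) (m n : ℕ) :
    HomRBO k A m →ₗ[k] HomRBO k A n →ₗ[k] CRBO k A :=
  LinearMap.mk₂ k (fun x y => lMixed lam (mulCochain k A) (q := 1)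
      ([⟨m, x⟩, ⟨n, y⟩] : List (Σ l : ℕ, HomRBO k A l)).get)
    (fun x x' y => wordRBO_injective (by
      simp only [map_add, wordRBO_lMixed_pair, DFinsupp.single_add]
      exact WordFun.bracket_add_left _ _ _ (isMultiadditive_wordRBO _)))
    (fun c x y => wordRBO_injective (by
      simp only [map_smul, wordRBO_lMixed_pair, DFinsupp.single_smul]
      exact WordFun.bracket_smul_left _ _ _ _ _ _))
    (fun x y y' => wordRBO_injective (by
      simp only [map_add, wordRBO_lMixed_pair, DFinsupp.single_add]
      exact WordFun.bracket_add_right _ _ _ (isMultiadditive_wordRBO _)))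
    (fun c x y => wordRBO_injective (by
      simp only [map_smul, wordRBO_lMixed_pair, DFinsupp.single_smul]
      exact WordFun.bracket_smul_right _ _ _ _ _ _))

/-- The operation `l₂^α` on `𝔠_RBO(A)`. -/
noncomputable def bracketRBO (lam : k) : CRBO k A →ₗ[k] CRBO k A →ₗ[k] CRBO k A :=
  DFinsupp.lsum k fun m => (DFinsupp.lsum k (M := fun n => HomRBO k A n)).toLinearMap ∘ₗ
    LinearMap.pi fun n => bracketHom lam m n

theorem bracketRBO_single_single (lam : k) {m n : ℕ} (x : HomRBO k A m) (y : HomRBO k A n) :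
    bracketRBO lam (DFinsupp.single m x) (DFinsupp.single n y) = bracketHom lam m n x y := by
  simp [bracketRBO]

theorem wordRBO_bracketRBO_single (lam : k) {m n : ℕ} (x : HomRBO k A m) (y : HomRBO k A n) :
    wordRBO (bracketRBO lam (DFinsupp.single m x) (DFinsupp.single n y))
      = WordFun.bracket (m : ℤ).negOnePow (n : ℤ).negOnePow (m * n : ℤ).negOnePow
        (wordRBO (DFinsupp.single m x)) (wordRBO (DFinsupp.single n y)) := by
  rw [bracketRBO_single_single]
  exact wordRBO_lMixed_pair lam x y

-- The double sum is the shape produced by `extendRBA`, for comparison with the twisted operation.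
open scoped Classical in
theorem bracketRBO_apply (lam : k) (x y : CRBO k A) :
    bracketRBO lam x y
      = x.sum fun m f => y.sum fun n g => lMixed lam (mulCochain k A) (q := 1)
        ([⟨m, f⟩, ⟨n, g⟩] : List (Σ l : ℕ, HomRBO k A l)).get := by
  have h (m : ℕ) (f : HomRBO k A m) (n : ℕ) (g : HomRBO k A n) :
      bracketRBO lam (DFinsupp.single m f) (DFinsupp.single n g)
        = lMixed lam (mulCochain k A) (q := 1)
          ([⟨m, f⟩, ⟨n, g⟩] : List (Σ l : ℕ, HomRBO k A l)).get :=
    bracketRBO_single_single lam f g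
  have h2 (m : ℕ) (f : HomRBO k A m) :
      bracketRBO lam (DFinsupp.single m f) y = y.sum fun n g =>
        lMixed lam (mulCochain k A) (q := 1)
          ([⟨m, f⟩, ⟨n, g⟩] : List (Σ l : ℕ, HomRBO k A l)).get := by
    rw [map_eq_sum_single (bracketRBO lam (DFinsupp.single m f)) y]
    simp only [h]
  have h3 := map_eq_sum_single ((bracketRBO lam).flip y) x
  simp only [LinearMap.flip_apply, h2] at h3
  exact h3

end Bilinear

/-! ### The grading of `𝔠_RBO(A)` -/

section Homogeneous

variable {k : Type*} [Field k] {A : Type*} [NonUnitalRing A] [Module k A]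

/-- Each degree contains at most one arity, so the graded identities need only be checked on
elements `DFinsupp.single n g`. -/
theorem eq_zero_or_single {i : ℤ} {x : CRBO k A} (hx : x ∈ rboDegree k A i) :
    x = 0 ∨ ∃ (n : ℕ) (g : HomRBO k A n), i = -n ∧ x = DFinsupp.single n g := by
  by_cases h : ∃ n : ℕ, i = -n
  · obtain ⟨n, rfl⟩ := h
    refine Or.inr ⟨n, x n, rfl, ?_⟩
    ext1 m
    by_cases hm : n = m
    · subst hm
      simp
    · rw [DFinsupp.single_eq_of_ne (Ne.symm hm)]
      exact hx m (by simpa using hm)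
  · push Not at h
    exact Or.inl (DFinsupp.ext fun n => hx n (h n))

theorem single_mem_rboDegree {n : ℕ} (g : HomRBO k A n) :
    DFinsupp.single n g ∈ rboDegree k A (-n) := fun m hm =>
  DFinsupp.single_eq_of_ne fun h => hm (by rw [h])

theorem mem_rboDegree {n : ℕ} {x : CRBO k A} (hx : IsHomogeneous n (wordRBO x : List A → A)) :
    x ∈ rboDegree k A (-n) := by
  have h : x = DFinsupp.single n (x n) := by
    apply wordRBO_injective
    ext w
    by_cases hw : w.length = n
    · subst hw
      rw [wordRBO_apply, wordRBO_apply, DFinsupp.single_eq_same]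
    · rw [hx w hw]
      exact (isHomogeneous_wordHomRBO ⟨n, x n⟩ w hw).symm
  rw [h]
  exact single_mem_rboDegree _

theorem isInternal_rboDegree : DirectSum.IsInternal (rboDegree k A) := by
  constructor
  · have hc (z : DirectSum ℤ fun i => rboDegree k A i) (n : ℕ) :
        DirectSum.coeAddMonoidHom (rboDegree k A) z n = (z (-n) : CRBO k A) n := by
      induction z using DirectSum.induction_on with
      | zero => simp
      | of i y =>
        rw [DirectSum.coeAddMonoidHom_of]
        by_cases hi : i = -n
        · subst hi
          rw [DirectSum.of_eq_same]
        · rw [DirectSum.of_eq_of_ne _ _ _ (Ne.symm hi)]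
          exact y.2 n hi
      | add y z hy hz => simp [hy, hz]
    intro z z' h
    refine DFinsupp.ext fun i => Subtype.ext (DFinsupp.ext fun n => ?_)
    by_cases hi : i = -n
    · subst hi
      rw [← hc, ← hc, h]
    · rw [(z i).2 n hi, (z' i).2 n hi]
  · intro x
    induction x using DFinsupp.induction with
    | h0 => exact ⟨0, map_zero _⟩
    | ha n g x _ _ ih =>
      obtain ⟨z, rfl⟩ := ih
      exact ⟨DirectSum.of (fun i => rboDegree k A i) (-n) ⟨_, single_mem_rboDegree g⟩ + z, by
        rw [map_add, DirectSum.coeAddMonoidHom_of]⟩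

end Homogeneous

/-! ### The graded Lie algebra structure -/

section DGLie

variable {k : Type*} [Field k] {A : Type*} [NonUnitalRing A] [Module k A]
  [IsScalarTower k A A] [SMulCommClass k A A]

theorem bracketRBO_mem (lam : k) {i j : ℤ} {x y : CRBO k A} (hx : x ∈ rboDegree k A i)
    (hy : y ∈ rboDegree k A j) : bracketRBO lam x y ∈ rboDegree k A (i + j) := by
  rcases eq_zero_or_single hx with rfl | ⟨m, f, rfl, rfl⟩
  · simp
  rcases eq_zero_or_single hy with rfl | ⟨n, g, rfl, rfl⟩
  · simp
  rw [show -(m : ℤ) + -(n : ℤ) = -((m + n : ℕ) : ℤ) by push_cast; ring]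
  apply mem_rboDegree
  rw [wordRBO_bracketRBO_single]
  exact WordFun.isHomogeneous_bracket (isHomogeneous_wordHomRBO ⟨m, f⟩)
    (isHomogeneous_wordHomRBO ⟨n, g⟩) (isMultiadditive_wordRBO _) (isMultiadditive_wordRBO _)

theorem bracketRBO_antisymm (lam : k) {i j : ℤ} {x y : CRBO k A} (hx : x ∈ rboDegree k A i)
    (hy : y ∈ rboDegree k A j) :
    bracketRBO lam x y + (i * j).negOnePow • bracketRBO lam y x = 0 := by
  rcases eq_zero_or_single hx with rfl | ⟨m, f, rfl, rfl⟩
  · simp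
  rcases eq_zero_or_single hy with rfl | ⟨n, g, rfl, rfl⟩
  · simp
  apply wordRBO_injective
  rw [map_add, map_zero, wordRBO_units_smul, wordRBO_bracketRBO_single, wordRBO_bracketRBO_single,
    neg_mul_neg, mul_comm (n : ℤ)]
  exact WordFun.bracket_antisymm

theorem exists_bracketRBO_single (lam : k) {m n : ℕ} (x : HomRBO k A m) (y : HomRBO k A n) :
    ∃ z : HomRBO k A (m + n),
      bracketRBO lam (DFinsupp.single m x) (DFinsupp.single n y) = DFinsupp.single (m + n) z := by
  have h := bracketRBO_mem lam (single_mem_rboDegree x) (single_mem_rboDegree y)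
  rcases eq_zero_or_single h with h | ⟨p, z, hp, h⟩
  · exact ⟨0, by rw [h, DFinsupp.single_zero]⟩
  · obtain rfl : p = m + n := by omega
    exact ⟨z, h⟩

/-- The inner bracket has arity `m + n`; its signs are split into products so as to have the form
required by `WordFun.bracket_jacobi`. -/
theorem wordRBO_bracketRBO_bracketRBO (lam : k) {m n p : ℕ} (x : HomRBO k A m) (y : HomRBO k A n)
    (z : HomRBO k A p) :
    wordRBO (bracketRBO lam (bracketRBO lam (DFinsupp.single m x) (DFinsupp.single n y))
        (DFinsupp.single p z))
      = WordFun.bracket ((m : ℤ).negOnePow * (n : ℤ).negOnePow) (p : ℤ).negOnePow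
        ((m * p : ℤ).negOnePow * (n * p : ℤ).negOnePow)
        (WordFun.bracket (m : ℤ).negOnePow (n : ℤ).negOnePow (m * n : ℤ).negOnePow
          (wordRBO (DFinsupp.single m x)) (wordRBO (DFinsupp.single n y)))
        (wordRBO (DFinsupp.single p z)) := by
  obtain ⟨u, hu⟩ := exists_bracketRBO_single lam x y
  rw [← wordRBO_bracketRBO_single lam, hu, wordRBO_bracketRBO_single, ← Int.negOnePow_add,
    ← Int.negOnePow_add, ← add_mul, ← Nat.cast_add]

theorem bracketRBO_jacobi (lam : k) {a b c : ℤ} {x y z : CRBO k A} (hx : x ∈ rboDegree k A a)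
    (hy : y ∈ rboDegree k A b) (hz : z ∈ rboDegree k A c) :
    bracketRBO lam (bracketRBO lam x y) z
      + (a * (b + c)).negOnePow • bracketRBO lam (bracketRBO lam y z) x
      + (c * (a + b)).negOnePow • bracketRBO lam (bracketRBO lam z x) y = 0 := by
  rcases eq_zero_or_single hx with rfl | ⟨m, f, rfl, rfl⟩
  · simp
  rcases eq_zero_or_single hy with rfl | ⟨n, g, rfl, rfl⟩
  · simp
  rcases eq_zero_or_single hz with rfl | ⟨p, h, rfl, rfl⟩
  · simp
  apply wordRBO_injective
  simp only [map_add, map_zero, wordRBO_units_smul, wordRBO_bracketRBO_bracketRBO]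
  have hm (m n : ℕ) : (m : ℤ).negOnePow ^ n = (m * n : ℤ).negOnePow :=
    (negOnePow_mul_natCast _ _).symm
  have hm' (m n : ℕ) : (m : ℤ).negOnePow ^ n = (n * m : ℤ).negOnePow := by rw [hm, mul_comm]
  have key := WordFun.bracket_jacobi (isHomogeneous_wordHomRBO ⟨m, f⟩)
    (isHomogeneous_wordHomRBO ⟨n, g⟩) (isHomogeneous_wordHomRBO ⟨p, h⟩)
    (isMultiadditive_wordRBO _) (isMultiadditive_wordRBO _) (isMultiadditive_wordRBO _)
    (hm m n) (hm' n m) (hm n p) (hm' p n) (hm m p) (hm' p m)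
  refine Eq.trans ?_ key
  have e1 : (-(m : ℤ) * (-(n : ℤ) + -(p : ℤ))).negOnePow
    = (m * n : ℤ).negOnePow * (m * p : ℤ).negOnePow := by rw [← Int.negOnePow_add]; congr 1; ring
  have e2 : (-(p : ℤ) * (-(m : ℤ) + -(n : ℤ))).negOnePow
    = (m * p : ℤ).negOnePow * (n * p : ℤ).negOnePow := by rw [← Int.negOnePow_add]; congr 1; ring
  rw [e1, e2, mul_comm (n : ℤ) m, mul_comm (p : ℤ) m, mul_comm (p : ℤ) n]
  rfl

end DGLie
-- The differential as an inner derivation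
section Differential

variable {k : Type*} [Field k] {A : Type*} [NonUnitalRing A] [Module k A]

theorem wordRBO_operatorElement (T : A →ₗ[k] A) (a : A) : wordRBO (operatorElement T) [a] = T a := by
  rw [wordRBO_apply]
  simp [operatorElement]

theorem isHomogeneous_operatorElement (T : A →ₗ[k] A) :
    IsHomogeneous 1 (wordRBO (operatorElement T) : List A → A) :=
  isHomogeneous_wordHomRBO ⟨1, _⟩

theorem wordRBO_operatorElement_id :
    wordRBO (operatorElement (LinearMap.id : A →ₗ[k] A)) = WordFun.letter := by
  ext w
  match w with
  | [a] => exact wordRBO_operatorElement _ a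
  | [] => exact isHomogeneous_operatorElement _ _ (by simp)
  | a :: b :: w => exact isHomogeneous_operatorElement _ _ (by simp)

theorem operatorElement_mem (T : A →ₗ[k] A) : operatorElement T ∈ rboDegree k A (-1) :=
  single_mem_rboDegree _

variable [IsScalarTower k A A] [SMulCommClass k A A]

/-- The operation `l₁^α` on `𝔠_RBO(A)`. -/
noncomputable def diffRBO (lam : k) : CRBO k A →ₗ[k] CRBO k A :=
  (-(lam / 2)) • bracketRBO lam (operatorElement LinearMap.id)

/-- The gauge operator of `y` sends the letter to `adLetter δ y`, which cancels both cup products;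
and `adLetter (-1) letter` is twice `letter * letter`. This explains the factor `-(lam / 2)` in
`diffRBO`. -/
theorem WordFun.bracket_letter (δ : ℤˣ) {y : WordFun A} (hy : IsMultiadditive (y : List A → A)) :
    WordFun.bracket (-1) δ δ WordFun.letter y
      = -(δ • WordFun.ins (-1) (letter * letter) y + δ • WordFun.ins (-1) (letter * letter) y) := by
  rw [bracket, gauge, ins_letter, gauge, adLetter, adLetter, Units.neg_smul, one_smul,
    sub_neg_eq_add, ins_add_left _ _ _ hy, smul_add]
  abel

theorem diffRBO_mem (lam : k) {i : ℤ} {x : CRBO k A} (hx : x ∈ rboDegree k A i) :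
    diffRBO lam x ∈ rboDegree k A (i - 1) := by
  have h := bracketRBO_mem lam (operatorElement_mem (LinearMap.id : A →ₗ[k] A)) hx
  rw [neg_add_eq_sub] at h
  exact (rboDegree k A (i - 1)).smul_mem _ h

/-- The Jacobi identity for an element of degree `-1`, with three applications of antisymmetry to
write it as a derivation rule. -/
theorem bracketRBO_bracketRBO (lam : k) {i j : ℤ} {c x y : CRBO k A} (hc : c ∈ rboDegree k A (-1))
    (hx : x ∈ rboDegree k A i) (hy : y ∈ rboDegree k A j) :
    bracketRBO lam c (bracketRBO lam x y) = bracketRBO lam (bracketRBO lam c x) y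
      + i.negOnePow • bracketRBO lam x (bracketRBO lam c y) := by
  have hcy : bracketRBO lam c y ∈ rboDegree k A (j - 1) := by
    rw [← neg_add_eq_sub]
    exact bracketRBO_mem lam hc hy
  have h2 := bracketRBO_jacobi lam hc hx hy
  have e3 := eq_neg_of_add_eq_zero_left (bracketRBO_antisymm lam (bracketRBO_mem lam hx hy) hc)
  have e4 := eq_neg_of_add_eq_zero_left (bracketRBO_antisymm lam hy hc)
  have e5 := eq_neg_of_add_eq_zero_left (bracketRBO_antisymm lam hcy hx)
  rw [e3, e4, map_neg, LinearMap.neg_apply, Units.smul_def, Units.smul_def, Units.smul_def,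
    Units.smul_def, map_zsmul, LinearMap.smul_apply, e5] at h2
  simp only [Units.smul_def, smul_neg, neg_neg, smul_smul, ← Units.val_mul,
    ← Int.negOnePow_add] at h2 ⊢
  have p1 : (-1 * (i + j) + (i + j) * -1).negOnePow = 1 :=
    Int.negOnePow_even _ ⟨-(i + j), by ring⟩
  have p2 : (j * (-1 + i) + (j * -1 + (j - 1) * i)).negOnePow = i.negOnePow := by
    rw [show j * (-1 + i) + (j * -1 + (j - 1) * i) = 2 * (j * i - j - i) + i by ring,
      Int.negOnePow_add, Int.negOnePow_even _ (even_two_mul _), one_mul]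
  rw [p1, p2] at h2
  simp only [Units.val_one, one_smul] at h2
  rw [← sub_eq_zero, ← neg_eq_zero, ← h2]
  abel

/-- This is associativity: on three letters the value is `(ab)c - a(bc)`. -/
theorem WordFun.ins_letter_mul_letter :
    ins (-1) (letter * letter) (letter * letter : WordFun A) = 0 := by
  rw [ins_mul _ _ isHomogeneous_letter (pow_one _), ins_letter, Units.neg_smul, one_smul, mul_assoc,
    add_neg_cancel]

/-- An inner operator satisfies the Leibniz rule by Jacobi; only the second argument has to be
decomposed into homogeneous components. -/
theorem diffRBO_bracketRBO (lam : k) {i : ℤ} {x : CRBO k A} (y : CRBO k A)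
    (hx : x ∈ rboDegree k A i) :
    diffRBO lam (bracketRBO lam x y) = bracketRBO lam (diffRBO lam x) y
      + i.negOnePow • bracketRBO lam x (diffRBO lam y) := by
  induction y using DFinsupp.induction with
  | h0 => simp
  | ha n g y _ _ ih =>
    have h := bracketRBO_bracketRBO lam (operatorElement_mem LinearMap.id) hx
      (single_mem_rboDegree g)
    have e : diffRBO lam (bracketRBO lam x (DFinsupp.single n g))
        = bracketRBO lam (diffRBO lam x) (DFinsupp.single n g)
          + i.negOnePow • bracketRBO lam x (diffRBO lam (DFinsupp.single n g)) := by
      simp only [diffRBO, LinearMap.smul_apply, map_smul, h, smul_add]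
      rw [smul_comm (-(lam / 2)) i.negOnePow]
    rw [map_add, map_add, map_add, map_add, map_add, ih, e]
    generalize i.negOnePow = u
    rcases Int.units_eq_one_or u with rfl | rfl <;> simp only [one_smul, Units.neg_smul] <;> abel

variable [CharZero k]

theorem wordRBO_diffRBO_single (lam : k) {n : ℕ} (g : HomRBO k A n) :
    wordRBO (diffRBO lam (DFinsupp.single n g)) = (n : ℤ).negOnePow • lam •
      WordFun.ins (-1) (WordFun.letter * WordFun.letter) (wordRBO (DFinsupp.single n g)) := by
  have h := wordRBO_bracketRBO_single lam (MultilinearMap.ofSubsingleton k (Susp A) A (0 : Fin 1)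
    (LinearMap.id ∘ₗ (susp k A).symm.toLinearMap)) g
  have e1 : ((1 : ℕ) : ℤ).negOnePow = -1 := rfl
  change wordRBO (bracketRBO lam (operatorElement LinearMap.id) _)
    = WordFun.bracket _ _ _ (wordRBO (operatorElement LinearMap.id)) _ at h
  rw [wordRBO_operatorElement_id, Nat.cast_one, one_mul] at h
  rw [diffRBO, LinearMap.smul_apply, map_smul, h, Int.negOnePow_one,
    WordFun.bracket_letter _ (isMultiadditive_wordRBO _), ← two_smul k, smul_neg, neg_smul, neg_neg,
    smul_smul, div_mul_cancel₀ _ two_ne_zero, smul_comm lam]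

-- In `insertion_insertion` with both inserted functions equal to the product, `s = -1` and the
-- commutator term is the associator, which vanishes. Hence the square equals its own negative, and
-- `2` is invertible.
omit [IsScalarTower k A A] [SMulCommClass k A A] in
theorem WordFun.ins_ins_letter_mul_letter (x : CRBO k A) :
    ins (-1) (letter * letter) (ins (-1) (letter * letter) (wordRBO x)) = 0 := by
  have hm := isHomogeneous_mul isHomogeneous_letter (isHomogeneous_letter (A := A))
  have h (w : List A) := insertion_insertion (p := 1) (q := 1) hm hm (ε := -1) (δ := -1) (s := -1)
    rfl rfl (isMultiadditive_wordRBO x) w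
  have e0 : (fun v => insertion (-1) (letter * letter : WordFun A) (letter * letter : WordFun A) v
      - (-1 : ℤˣ) • insertion (-1) (letter * letter : WordFun A) (letter * letter : WordFun A) v)
      = fun _ => 0 := by
    funext v
    have : insertion (-1) (letter * letter : WordFun A) (letter * letter : WordFun A) v = 0 :=
      congrFun ins_letter_mul_letter v
    rw [this, smul_zero, sub_zero]
  ext w
  have hw := h w
  rw [e0] at hw
  have e1 : insertion (-1 * -1) (fun _ : List A => (0 : A)) (wordRBO x) w = 0 :=
    congrFun (ins_zero_left (-1 * -1) (isMultiadditive_wordRBO x)) w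
  rw [e1, add_zero, Units.neg_smul, one_smul] at hw
  rw [eq_neg_iff_add_eq_zero, ← two_smul k] at hw
  exact (smul_eq_zero.mp hw).resolve_left two_ne_zero

theorem diffRBO_diffRBO (lam : k) (x : CRBO k A) : diffRBO lam (diffRBO lam x) = 0 := by
  induction x using DFinsupp.induction with
  | h0 => simp
  | ha n g x _ _ ih =>
    rw [map_add, map_add, ih, add_zero]
    have h := diffRBO_mem lam (single_mem_rboDegree g)
    rcases eq_zero_or_single h with h | ⟨m, f, hm, h⟩
    · rw [h, map_zero]
    · apply wordRBO_injective
      rw [h, wordRBO_diffRBO_single, ← h, wordRBO_diffRBO_single, WordFun.ins_units_smul,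
        WordFun.ins_smul, WordFun.ins_ins_letter_mul_letter]
      simp

variable (k A) in
/-- The dg Lie algebra `(𝔠_RBO(A), l₁^α, l₂^α)`. -/
noncomputable def dgLieRBO (lam : k) : DGLieAlgebra k (CRBO k A) (rboDegree k A) where
  l₁ := diffRBO lam
  l₂ := bracketRBO lam
  internal := isInternal_rboDegree
  l₁_mem _ _ hx := diffRBO_mem lam hx
  l₂_mem _ _ _ _ hx hy := bracketRBO_mem lam hx hy
  l₁_l₁ := diffRBO_diffRBO lam
  l₁_l₂ _ _ y hx := diffRBO_bracketRBO lam y hx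
  antisymm _ _ _ _ hx hy := bracketRBO_antisymm lam hx hy
  jacobi _ _ _ _ _ _ hx hy hz := bracketRBO_jacobi lam hx hy hz

end Differential
-- Rota–Baxter operators as Maurer–Cartan elements
namespace WordFun

variable {A : Type*} [NonUnitalRing A]

theorem mul_apply_of_isHomogeneous {n : ℕ} {x y : WordFun A} (hx : IsHomogeneous n x)
    {w : List A} (hw : n ≤ w.length) : (x * y) w = x (w.take n) * y (w.drop n) :=
  conv_eq_of_isHomogeneous hx (φ := fun b => mulHom y b) (fun v => zero_mul (y v)) hw

/-- A function of one letter leaves no room beside the inserted value, so the insertion is plain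
composition and the sign is trivial. -/
theorem insertion_unary (ε : ℤˣ) (h : List A → A) {f : List A → A} (hf : IsHomogeneous 1 f)
    (h0 : f [0] = 0) (w : List A) : insertion ε h f w = f [h w] := by
  have h0' (v : List A) : f (0 :: v) = 0 := by
    cases v with
    | nil => exact h0
    | cons a v => exact hf _ (by simp)
  have hc (h : List A → A) (w : List A) : conv h (fun b v => f (b :: v)) w = f [h w] := by
    induction w generalizing h with
    | nil => rfl
    | cons a w ih => rw [conv, ih, hf (h [] :: a :: w) (by simp), zero_add]
  cases w with
  | nil => rfl
  | cons a w =>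
    rw [insertion, hc, insertion_eq_zero ε h (f := fun v => f (a :: v))
      (fun b v => hf _ (by simp)), smul_zero, add_zero]

end WordFun

section MaurerCartan

variable {k : Type*} [Field k] {A : Type*} [NonUnitalRing A] [Module k A]

theorem wordRBO_eq_zero {i : ℤ} {x : CRBO k A} (hx : x ∈ rboDegree k A i) {w : List A}
    (hw : i ≠ -(w.length : ℤ)) : wordRBO x w = 0 := by
  rw [wordRBO_apply, hx _ hw]
  rfl

theorem insertion_wordRBO_operatorElement (T : A →ₗ[k] A) (ε : ℤˣ) (h : WordFun A) (w : List A) :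
    WordFun.ins ε h (wordRBO (operatorElement T)) w = T (h w) := by
  rw [WordFun.ins_apply, WordFun.insertion_unary ε h (isHomogeneous_operatorElement T)]
  · exact wordRBO_operatorElement T _
  · exact (wordRBO_operatorElement T 0).trans (map_zero T)

theorem operatorElement_injective :
    Function.Injective (operatorElement : (A →ₗ[k] A) → CRBO k A) := by
  intro T T' h
  ext a
  rw [← wordRBO_operatorElement, h, wordRBO_operatorElement]

theorem exists_operatorElement {x : CRBO k A} (hx : x ∈ rboDegree k A (-1)) :
    ∃ T : A →ₗ[k] A, operatorElement T = x := by
  rcases eq_zero_or_single hx with rfl | ⟨n, g, hn, rfl⟩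
  · exact ⟨0, by
      refine (congrArg (DFinsupp.single 1) ?_).trans (DFinsupp.single_zero 1)
      ext v
      rfl⟩
  · obtain rfl : n = 1 := by omega
    refine ⟨(MultilinearMap.ofSubsingleton k (Susp A) A (0 : Fin 1)).symm g ∘ₗ
      (susp k A).toLinearMap, congrArg (DFinsupp.single 1) ?_⟩
    ext v
    simp only [MultilinearMap.ofSubsingleton_apply_apply, LinearMap.comp_apply,
      LinearEquiv.coe_coe, LinearEquiv.apply_symm_apply,
      MultilinearMap.ofSubsingleton_symm_apply_apply]
    exact congrArg g (funext fun i => congrArg v (Subsingleton.elim _ _))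

/-- The product `⋆` as a function of words of length `2`. -/
noncomputable def starWord (lam : k) (T : A →ₗ[k] A) : WordFun A :=
  lam • (WordFun.letter * WordFun.letter) + WordFun.adLetter (-1) (wordRBO (operatorElement T))

theorem isHomogeneous_starWord (lam : k) (T : A →ₗ[k] A) :
    IsHomogeneous 2 (starWord lam T : List A → A) := by
  intro w hw
  have e : (lam • (WordFun.letter * WordFun.letter : WordFun A)) w = 0 := by
    have := WordFun.isHomogeneous_mul WordFun.isHomogeneous_letter
      (WordFun.isHomogeneous_letter (A := A)) w hw
    exact (congrArg (lam • ·) this).trans (smul_zero _)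
  rw [starWord, WordFun.add_apply, e, WordFun.isHomogeneous_adLetter _ (isHomogeneous_operatorElement T) w hw,
    add_zero]

variable [IsScalarTower k A A] [SMulCommClass k A A]

theorem wordRBO_bracketRBO_operatorElement (lam : k) (T : A →ₗ[k] A) {n : ℕ} (g : HomRBO k A n) :
    wordRBO (bracketRBO lam (operatorElement T) (DFinsupp.single n g))
      = WordFun.bracket (-1) (n : ℤ).negOnePow (n : ℤ).negOnePow (wordRBO (operatorElement T))
        (wordRBO (DFinsupp.single n g)) := by
  have h := wordRBO_bracketRBO_single lam (MultilinearMap.ofSubsingleton k (Susp A) A (0 : Fin 1)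
    (T ∘ₗ (susp k A).symm.toLinearMap)) g
  rw [Nat.cast_one, one_mul, Int.negOnePow_one] at h
  exact h

theorem starWord_apply (lam : k) (T : A →ₗ[k] A) (a b : A) :
    starWord lam T [a, b] = starProduct lam T a b := by
  have hT := isHomogeneous_operatorElement (k := k) T
  have hL := WordFun.isHomogeneous_letter (A := A)
  have e : (lam • (WordFun.letter * WordFun.letter : WordFun A)) [a, b] = lam • (a * b) :=
    congrArg (lam • ·) (WordFun.mul_apply_of_isHomogeneous hL (by simp))
  rw [starWord, WordFun.add_apply, e, WordFun.adLetter, WordFun.sub_apply, WordFun.units_smul_apply,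
    WordFun.mul_apply_of_isHomogeneous hT (by simp),
    WordFun.mul_apply_of_isHomogeneous hL (by simp)]
  simp only [List.take, List.drop, wordRBO_operatorElement, WordFun.letter, Units.neg_smul,
    one_smul, starProduct, LinearMap.mk₂_apply]
  abel

variable [CharZero k]

/-- The gauge operator of `T` inserts `adLetter (-1) T`, that is `T(a)b + aT(b)`; added to the
`λ`-term of the differential it becomes the insertion of `⋆`. -/
theorem wordRBO_twisted_single (lam : k) (T : A →ₗ[k] A) {n : ℕ} (g : HomRBO k A n) :
    wordRBO (diffRBO lam (DFinsupp.single n g)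
        - bracketRBO lam (operatorElement T) (DFinsupp.single n g))
      = (n : ℤ).negOnePow • WordFun.ins (-1) (starWord lam T) (wordRBO (DFinsupp.single n g))
        - (n : ℤ).negOnePow • (wordRBO (operatorElement T) * wordRBO (DFinsupp.single n g))
        + wordRBO (DFinsupp.single n g) * wordRBO (operatorElement T)
        - WordFun.gauge (n : ℤ).negOnePow (wordRBO (DFinsupp.single n g))
          (wordRBO (operatorElement T)) := by
  rw [map_sub, wordRBO_diffRBO_single, wordRBO_bracketRBO_operatorElement, starWord,
    WordFun.ins_add_left _ _ _ (isMultiadditive_wordRBO _), WordFun.ins_smul_left,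
    WordFun.bracket, smul_add]
  change _ = _ + _ • WordFun.gauge (-1) _ _ - _ + _ - _
  abel

theorem isMaurerCartan_operatorElement_iff (lam : k) (T : A →ₗ[k] A) :
    (dgLieRBO k A lam).IsMaurerCartan (operatorElement T) ↔ IsRotaBaxter lam T := by
  set β := operatorElement T
  have hT := isHomogeneous_operatorElement (k := k) T
  have hL := WordFun.isHomogeneous_letter (A := A)
  -- In degree `-1` the bracket of `β` with itself is twice a difference, so the coefficient `1/2`
  -- disappears.
  have key (a b : A) : wordRBO (diffRBO lam β - (1 / 2 : k) • bracketRBO lam β β) [a, b]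
      = T a * T b - T (a * T b + T a * b + lam • (a * b)) := by
    have e1 : wordRBO (diffRBO lam β) = -(lam • WordFun.ins (-1)
        (WordFun.letter * WordFun.letter) (wordRBO β)) := by
      refine (wordRBO_diffRBO_single lam _).trans ?_
      rw [Nat.cast_one, Int.negOnePow_one, Units.neg_smul, one_smul]
      rfl
    have e2 : wordRBO (bracketRBO lam β β)
        = WordFun.bracket (-1) (-1) (-1) (wordRBO β) (wordRBO β) :=
      wordRBO_bracketRBO_operatorElement lam T _
    have e3 : WordFun.bracket (-1) (-1) (-1) (wordRBO β) (wordRBO β)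
        = (2 : k) • (WordFun.gauge (-1) (wordRBO β) (wordRBO β) - wordRBO β * wordRBO β) := by
      rw [WordFun.bracket, two_smul]
      simp only [Units.neg_smul, one_smul]
      abel
    have e4 : (lam • WordFun.ins (-1) (WordFun.letter * WordFun.letter) (wordRBO β)) [a, b]
        = lam • T (a * b) := by
      refine congrArg (lam • ·) ((insertion_wordRBO_operatorElement T _ _ _).trans ?_)
      rw [WordFun.mul_apply_of_isHomogeneous hL (by simp)]
      rfl
    have e5 : WordFun.gauge (-1) (wordRBO β) (wordRBO β) [a, b] = T (T a * b + a * T b) := by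
      refine (insertion_wordRBO_operatorElement T _ _ _).trans ?_
      rw [WordFun.adLetter, WordFun.sub_apply, WordFun.units_smul_apply,
        WordFun.mul_apply_of_isHomogeneous hT (by simp),
        WordFun.mul_apply_of_isHomogeneous hL (by simp)]
      simp only [List.take, List.drop, β, wordRBO_operatorElement, WordFun.letter, Units.neg_smul,
        one_smul, sub_neg_eq_add]
    rw [map_sub, map_smul, e1, e2, e3, smul_smul, one_div, inv_mul_cancel₀ two_ne_zero, one_smul,
      WordFun.sub_apply, WordFun.neg_apply, e4, WordFun.sub_apply, e5,
      WordFun.mul_apply_of_isHomogeneous hT (by simp)]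
    simp only [List.take, List.drop, β, wordRBO_operatorElement, map_add, map_smul]
    abel
  constructor
  · intro h a b
    have h2 : diffRBO lam β - (1 / 2 : k) • bracketRBO lam β β = 0 := h.2
    have e := key a b
    rw [h2, map_zero, WordFun.zero_apply] at e
    exact sub_eq_zero.mp e.symm
  · intro h
    refine ⟨operatorElement_mem T, wordRBO_injective ?_⟩
    change wordRBO (diffRBO lam β - (1 / 2 : k) • bracketRBO lam β β) = _
    -- The Maurer–Cartan expression has degree `-2`, so two-letter words determine it.
    have hm : diffRBO lam β - (1 / 2 : k) • bracketRBO lam β β ∈ rboDegree k A (-2) :=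
      Submodule.sub_mem _ (diffRBO_mem lam (operatorElement_mem T)) (Submodule.smul_mem _ _
        (bracketRBO_mem lam (operatorElement_mem T) (operatorElement_mem T)))
    rw [map_zero]
    ext w
    by_cases hw : w.length = 2
    · match w, hw with
      | [a, b], _ => rw [key, h a b, sub_self]; rfl
    · exact wordRBO_eq_zero hm (by omega)

theorem bijOn_operatorElement (lam : k) :
    Set.BijOn operatorElement {T : A →ₗ[k] A | IsRotaBaxter lam T}
      {β : CRBO k A | (dgLieRBO k A lam).IsMaurerCartan β} := by
  refine ⟨fun T hT => (isMaurerCartan_operatorElement_iff lam T).mpr hT,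
    operatorElement_injective.injOn, fun β hβ => ?_⟩
  obtain ⟨T, rfl⟩ := exists_operatorElement hβ.1
  exact ⟨T, (isMaurerCartan_operatorElement_iff lam T).mp hβ, rfl⟩

end MaurerCartan

/-! ### The twisted differential as the Hochschild differential -/

section Twist

variable {k : Type*} [Field k] {A : Type*}

theorem negOnePow_natCast_smul {M : Type*} [AddCommGroup M] [Module k M] (n : ℕ) (x : M) :
    (n : ℤ).negOnePow • x = (-1 : k) ^ n • x := by
  rcases Nat.even_or_odd n with hn | hn
  · rw [hn.neg_one_pow, Int.negOnePow_even _ (by exact_mod_cast hn), one_smul, one_smul]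
  · rw [hn.neg_one_pow, Int.negOnePow_odd _ (by exact_mod_cast hn), Units.neg_smul, one_smul,
      neg_one_smul]

theorem take_ofFn_castSucc {n : ℕ} (a : Fin (n + 1) → A) :
    (List.ofFn a).take n = List.ofFn fun j : Fin n => a j.castSucc :=
  List.ext_getElem (by simp) fun j h1 h2 => by
    simp [-List.ofFn_succ]

theorem drop_ofFn_last {n : ℕ} (a : Fin (n + 1) → A) :
    (List.ofFn a).drop n = [a (Fin.last n)] :=
  List.ext_getElem (by simp) fun j h1 h2 => by
    simp at h1
    subst h1
    simp [-List.ofFn_succ]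
    rfl

/-- Identifies inserting a two-letter function into a word with `Fin.contractNth` on tuples. -/
theorem ofFn_contractNth (op : A → A → A) {n : ℕ} (a : Fin (n + 1) → A) (i : Fin n)
    (h : List A → A) (hh : ∀ x y, h [x, y] = op x y) :
    (List.ofFn a).take i ++ h (((List.ofFn a).drop i).take 2) :: (List.ofFn a).drop (i + 2)
      = List.ofFn (Fin.contractNth i.castSucc op a) := by
  have hi := i.2
  have e : ((List.ofFn a).drop i).take 2 = [a i.castSucc, a i.succ] := by
    refine List.ext_getElem (by simp; omega) fun j h1 h2 => ?_
    match j, h2 with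
    | 0, _ => simp [-List.ofFn_succ]; rfl
    | 1, _ => simp [-List.ofFn_succ]; rfl
  rw [e, hh]
  refine List.ext_getElem (by simp; omega) fun j h1 h2 => ?_
  simp only [List.length_ofFn] at h2
  rw [List.getElem_ofFn]
  rcases lt_trichotomy j i with hj | hj | hj
  · rw [List.getElem_append_left (by simp; omega), Fin.contractNth_apply_of_lt _ _ _ _ hj]
    simp [-List.ofFn_succ]
  · subst hj
    rw [List.getElem_append_right (by simp), Fin.contractNth_apply_of_eq _ _ _ _ rfl]
    simp [show min (i : ℕ) (n + 1) = i by omega]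
  · rw [List.getElem_append_right (by simp; omega), Fin.contractNth_apply_of_gt _ _ _ _ hj]
    obtain ⟨t, rfl⟩ : ∃ t, j = i + 1 + t := ⟨j - (i + 1), by omega⟩
    simp [show min (i : ℕ) (n + 1) = i by omega, show (i : ℕ) + 1 + t - i = t + 1 by omega]

variable [NonUnitalRing A] [Module k A]

theorem wordRBO_single_ofFn {n : ℕ} (g : HomRBO k A n) (v : Fin n → A) :
    wordRBO (DFinsupp.single n g) (List.ofFn v) = hat k A n g v := by
  refine (wordAlg_ofFn _ v).trans ?_
  change (DFinsupp.single n g : CRBO k A) n _ = _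
  rw [DFinsupp.single_eq_same]
  rfl

variable [IsScalarTower k A A] [SMulCommClass k A A] [CharZero k]

/-- On `n + 1` letters, inserting `⋆` gives the inner Hochschild terms. The two cup products with
`T` give `T(a)f` and `fT(a)`; the gauge term gives `-T(af)` and `-T(fa)` with matching signs,
completing `▷` and `◁`. -/
theorem twisted_single (lam : k) (T : A →ₗ[k] A) {n : ℕ} (g : HomRBO k A n) :
    diffRBO lam (DFinsupp.single n g) - bracketRBO lam (operatorElement T) (DFinsupp.single n g)
      = DFinsupp.single (n + 1) ((hat k A (n + 1)).symm (rboDiff lam T (hat k A n g))) := by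
  have hm : diffRBO lam (DFinsupp.single n g)
      - bracketRBO lam (operatorElement T) (DFinsupp.single n g) ∈ rboDegree k A (-n - 1) :=
    Submodule.sub_mem _ (diffRBO_mem lam (single_mem_rboDegree g)) (by
      rw [← neg_add_eq_sub]
      exact bracketRBO_mem lam (operatorElement_mem T) (single_mem_rboDegree g))
  apply wordRBO_injective
  ext w
  by_cases hw : w.length = n + 1
  swap
  · rw [wordRBO_eq_zero hm (by omega)]
    exact (isHomogeneous_wordHomRBO ⟨n + 1, _⟩ w hw).symm
  obtain ⟨a, rfl⟩ : ∃ a : Fin (n + 1) → A, w = List.ofFn a :=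
    ⟨fun i => w.get (i.cast hw.symm), List.ext_getElem (by simp [hw]) fun j h1 h2 => by
      simp [-List.ofFn_succ]⟩
  have hT := isHomogeneous_operatorElement (k := k) T
  have hL := WordFun.isHomogeneous_letter (A := A)
  have hG : IsHomogeneous n (wordRBO (DFinsupp.single n g) : List A → A) :=
    isHomogeneous_wordHomRBO ⟨n, g⟩
  have e0 : (List.ofFn a).take 1 = [a 0] := by simp [List.ofFn_succ]
  have e1 : (List.ofFn a).drop 1 = List.ofFn fun j : Fin n => a j.succ := by simp [List.ofFn_succ]
  rw [wordRBO_twisted_single, wordRBO_single_ofFn, LinearEquiv.apply_symm_apply, rboDiff,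
    hochschildDiff_apply]
  simp only [WordFun.add_apply, WordFun.sub_apply, WordFun.units_smul_apply]
  rw [WordFun.mul_apply_of_isHomogeneous hT (by simp),
    WordFun.mul_apply_of_isHomogeneous hG (by simp), WordFun.ins_apply,
    insertion_eq_sum (-1) (isHomogeneous_starWord lam T) hG (isMultiadditive_wordRBO _) (by simp),
    WordFun.gauge, insertion_wordRBO_operatorElement, WordFun.adLetter, WordFun.sub_apply,
    WordFun.units_smul_apply, WordFun.mul_apply_of_isHomogeneous hG (by simp),
    WordFun.mul_apply_of_isHomogeneous hL (by simp), e0, e1, take_ofFn_castSucc, drop_ofFn_last,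
    wordRBO_single_ofFn, wordRBO_single_ofFn, wordRBO_operatorElement, wordRBO_operatorElement]
  have es : (n : ℤ).negOnePow • ∑ i ∈ Finset.range n, (-1 : ℤˣ) ^ i •
      wordRBO (DFinsupp.single n g) ((List.ofFn a).take i ++
        starWord lam T (((List.ofFn a).drop i).take 2) ::
        (List.ofFn a).drop (i + 2))
      = ∑ i : Fin n, (-1 : k) ^ (n - (i : ℕ)) • hat k A n g
        (Fin.contractNth i.castSucc (fun x y => starProduct lam T x y) a) := by
    rw [Finset.smul_sum, Finset.sum_range]
    refine Finset.sum_congr rfl fun i _ => ?_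
    rw [ofFn_contractNth (fun x y => starProduct lam T x y) a i _ (starWord_apply lam T),
      wordRBO_single_ofFn, ← negOnePow_natCast_smul, smul_smul, negOnePow_natCast,
      negOnePow_natCast, ← pow_add]
    congr 1
    have hi := i.2
    -- The degree sign `(-1)^n` and the `i` crossed letters combine to `(-1)^(n - i)`, since `2 * i`
    -- does not affect parity.
    rw [show n + (i : ℕ) = n - i + 2 * i by omega, pow_add, pow_mul, Int.units_sq, one_pow,
      mul_one]
  rw [es]
  simp only [leftAction, rightAction, LinearMap.mk₂_apply, WordFun.letter,
    negOnePow_natCast_smul (k := k), map_sub, map_smul, smul_sub, pow_succ, mul_neg_one, neg_smul]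
  abel

theorem twist_l₁_single (lam : k) (T : A →ₗ[k] A)
    (hT : (dgLieRBO k A lam).IsMaurerCartan (operatorElement T)) {n : ℕ} (g : HomRBO k A n) :
    ((dgLieRBO k A lam).twist (operatorElement T) hT).l₁ (DFinsupp.single n g)
      = DFinsupp.single (n + 1) ((hat k A (n + 1)).symm (rboDiff lam T (hat k A n g))) :=
  twisted_single lam T g

/-- No Hochschild computation is needed: the twisted differential squares to zero by
`DGLieAlgebra.twist`, and `twist_l₁_single` transports this to `rboDiff`. -/
theorem rboDiff_rboDiff (lam : k) {T : A →ₗ[k] A} (hT : IsRotaBaxter lam T) {n : ℕ}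
    (f : MultilinearMap k (fun _ : Fin n => A) A) : rboDiff lam T (rboDiff lam T f) = 0 := by
  have hT' := (isMaurerCartan_operatorElement_iff lam T).mpr hT
  have h := ((dgLieRBO k A lam).twist (operatorElement T) hT').l₁_l₁
    (DFinsupp.single n ((hat k A n).symm f))
  rw [twist_l₁_single, twist_l₁_single, LinearEquiv.apply_symm_apply,
    LinearEquiv.apply_symm_apply, DFinsupp.single_eq_zero] at h
  exact (LinearEquiv.map_eq_zero_iff _).mp h

end Twist
-- Multilinear extension from homogeneous elements
section Extension

variable {k : Type*} [Field k] {A : Type*} [AddCommGroup A] [Module k A]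
  {M : Type*} [AddCommMonoid M]

theorem extendRBA_mem (S : AddSubmonoid M) (phi : List (HomElt k A) → M) (xs : List (CRBA k A))
    (h : ∀ ys : List (HomElt k A), ys.length = xs.length → phi ys ∈ S) : extendRBA phi xs ∈ S := by
  induction xs generalizing phi with
  | nil => exact h [] rfl
  | cons x xs ih =>
    exact S.add_mem
      (S.sum_mem fun n _ => ih _ fun ys hy => h _ (by simpa using hy))
      (S.sum_mem fun n _ => ih _ fun ys hy => h _ (by simpa using hy))

theorem extendRBA_nil (phi : List (HomElt k A) → M) : extendRBA phi [] = phi [] := rfl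

theorem extendRBA_rbo_cons (phi : List (HomElt k A) → M) (x : CRBO k A) (xs : List (CRBA k A))
    [∀ n (g : HomRBO k A n), Decidable (g ≠ 0)] :
    extendRBA phi ((0, x) :: xs)
      = x.sum fun n g => extendRBA (fun ys => phi (.rbo n g :: ys)) xs := by
  classical
  refine (congrArg₂ (· + ·) DFinsupp.sum_zero_index rfl).trans ((zero_add _).trans ?_)
  congr!

/-- Serves with `⊥` to prove vanishing and with the kernel of the first projection to prove closure
of `𝔠_RBO(A)`; either is then tested on homogeneous entries only. -/
theorem extendRBA_rbo_mem (S : AddSubmonoid M) (phi : List (HomElt k A) → M)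
    (xs : List (CRBO k A)) (h : ∀ ys : List (Σ l : ℕ, HomRBO k A l), ys.length = xs.length →
      phi (ys.map fun g => .rbo g.1 g.2) ∈ S) :
    extendRBA phi (xs.map fun x => (0, x)) ∈ S := by
  classical
  induction xs generalizing phi with
  | nil => exact h [] rfl
  | cons x xs ih =>
    rw [List.map_cons, extendRBA_rbo_cons]
    exact S.sum_mem fun n _ => ih _ fun ys hy => h (⟨n, x n⟩ :: ys) (by simpa using hy)

theorem extendRBA_alg_cons (phi : List (HomElt k A) → M) {n : ℕ} (f : HomAlg k A n)
    (xs : List (CRBA k A)) (h : extendRBA (fun ys => phi (.alg n 0 :: ys)) xs = 0) :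
    extendRBA phi ((DFinsupp.single n f, 0) :: xs)
      = extendRBA (fun ys => phi (.alg n f :: ys)) xs := by
  classical
  exact (congrArg₂ (· + ·) (DFinsupp.sum_single_index h) DFinsupp.sum_zero_index).trans (add_zero _)

end Extension

/-! ### The twisted operations and the Maurer–Cartan element -/

section Components

variable {k : Type*} [Field k] {A : Type*} [NonUnitalRing A] [Module k A]

theorem allRBO_map (gs : List (Σ l : ℕ, HomRBO k A l)) :
    allRBO (gs.map fun g => HomElt.rbo g.1 g.2) = some gs := by
  induction gs with
  | nil => rfl
  | cons g gs ih => simp [allRBO, ih]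

theorem isolate_map (gs : List (Σ l : ℕ, HomRBO k A l)) :
    isolate (gs.map fun g => HomElt.rbo g.1 g.2) = none := by
  induction gs with
  | nil => rfl
  | cons g gs ih => simp [isolate, ih]

theorem lHom_rbo (lam : k) (gs : List (Σ l : ℕ, HomRBO k A l)) :
    lHom lam (gs.map fun g => HomElt.rbo g.1 g.2) = 0 := by
  have h := isolate_map gs
  match gs with
  | [] => simp [lHom, isolate]
  | g :: gs =>
    simp only [List.map_cons] at h ⊢
    simp [lHom, h]

theorem lHom_alg_alg (lam : k) {m n : ℕ} (f : HomAlg k A m) (g : HomAlg k A n)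
    {ys : List (HomElt k A)} (h : ys ≠ []) : lHom lam (.alg m f :: .alg n g :: ys) = 0 := by
  match ys, h with
  | y :: ys, _ => simp [lHom, isolate, allRBO]

theorem lHom_alg_rbo (lam : k) {p : ℕ} (h : HomAlg k A p) (g : Σ l : ℕ, HomRBO k A l)
    (gs : List (Σ l : ℕ, HomRBO k A l)) :
    lHom lam (.alg p h :: (g :: gs).map fun g => HomElt.rbo g.1 g.2)
      = (0, lMixed lam h fun i : Fin (gs.length + 1) => (g :: gs).get i) := by
  have e := allRBO_map (g :: gs)
  simp only [List.map_cons] at e ⊢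
  simp [lHom, isolate, e]

theorem brace_zero_left (gs : List (CAlg k A)) : brace (0 : CAlg k A) gs = 0 := by
  classical
  exact DFinsupp.sum_zero_index

theorem brace_zero_right (f : CAlg k A) : brace f [0] = 0 := by
  classical
  exact Finset.sum_eq_zero fun _ _ => DFinsupp.sum_zero_index

theorem lMixed_zero (lam : k) {p q : ℕ} (g : Fin (q + 1) → Σ l : ℕ, HomRBO k A l) :
    lMixed lam (0 : HomAlg k A p) g = 0 := by
  refine Finset.sum_eq_zero fun σ _ => ?_
  simp [DFinsupp.single_zero, brace_zero_left, brace_zero_right]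

/-- The only component with two entries in `𝔠_Alg(A)` is the binary Gerstenhaber bracket, so a
further entry forces zero. This makes the sums over `i` finite. -/
theorem lOp_alg_alg (lam : k) (x y : CAlg k A) {xs : List (CRBA k A)} (h : xs ≠ []) :
    lOp lam ((x, 0) :: (y, 0) :: xs) = 0 := by
  classical
  have hl (m n : ℕ) (f : HomAlg k A m) (g : HomAlg k A n) :
      extendRBA (fun ys => lHom lam (.alg m f :: .alg n g :: ys)) xs = 0 :=
    extendRBA_mem (⊥ : AddSubmonoid (CRBA k A)) _ _ fun ys hy => lHom_alg_alg lam f g (by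
      rintro rfl
      exact h (List.length_eq_zero_iff.mp hy.symm))
  refine (congrArg₂ (· + ·) (Finset.sum_eq_zero fun m _ => ?_) DFinsupp.sum_zero_index).trans
    (add_zero _)
  exact (congrArg₂ (· + ·) (Finset.sum_eq_zero fun n _ => hl m n _ _)
    DFinsupp.sum_zero_index).trans (add_zero _)

variable [IsScalarTower k A A] [SMulCommClass k A A]

theorem twistedTerm_eq_zero (lam : k) {xs : List (CRBA k A)} (h : xs ≠ []) {i : ℕ} (hi : 2 ≤ i) :
    twistedTerm lam (mulElement k A) xs i = 0 := by
  obtain ⟨i, rfl⟩ := Nat.exists_eq_add_of_le' hi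
  rw [twistedTerm, List.replicate_succ, List.replicate_succ, List.cons_append, List.cons_append,
    mulElement, lOp_alg_alg _ _ _ (by simp [h]), smul_zero]

theorem support_twistedTerm_finite (lam : k) {xs : List (CRBA k A)} (h : xs ≠ []) :
    (Function.support (twistedTerm lam (mulElement k A) xs)).Finite := by
  refine (Set.finite_lt_nat 2).subset fun i hi => ?_
  by_contra hi'
  exact hi (twistedTerm_eq_zero lam h (not_lt.mp hi'))

theorem twistedOp_rbo (lam : k) {xs : List (CRBO k A)} (h : xs ≠ []) :
    twistedOp lam (mulElement k A) (xs.map fun x => (0, x))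
      = (-1 : k) ^ xs.length • extendRBA (fun ys => lHom lam (.alg 2 (mulCochain k A) :: ys))
        (xs.map fun x => (0, x)) := by
  have h' : (xs.map fun x => ((0, x) : CRBA k A)) ≠ [] := by simpa using h
  have h0 : extendRBA (lHom lam) (xs.map fun x => (0, x)) = 0 :=
    extendRBA_rbo_mem (⊥ : AddSubmonoid (CRBA k A)) _ _ fun ys _ => lHom_rbo lam ys
  have h1 : extendRBA (fun ys => lHom lam (.alg 2 0 :: ys)) (xs.map fun x => (0, x)) = 0 :=
    extendRBA_rbo_mem (⊥ : AddSubmonoid (CRBA k A)) _ _ fun ys hy => by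
      match ys, hy with
      | [], hy => exact absurd (List.length_eq_zero_iff.mp hy.symm) h
      | g :: gs, _ =>
        rw [lHom_alg_rbo, lMixed_zero]
        rfl
  -- The term `i = 0` has all its entries in `𝔠_RBO(A)` and vanishes; the terms `i ≥ 2` contain `α`
  -- twice together with another entry.
  rw [twistedOp, finsum_eq_single _ 1]
  · simp only [twistedTerm, List.replicate_one, List.singleton_append, lOp, mulElement,
      List.length_map]
    rw [extendRBA_alg_cons _ _ _ h1]
    simp
  · intro i hi
    rcases Nat.lt_or_ge i 2 with hi2 | hi2
    · obtain rfl : i = 0 := by omega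
      simp [twistedTerm, lOp, h0]
    · exact twistedTerm_eq_zero lam h' hi2

theorem twistedOp_rbo_fst (lam : k) {xs : List (CRBO k A)} (h : xs ≠ []) :
    (twistedOp lam (mulElement k A) (xs.map fun x => (0, x))).1 = 0 := by
  rw [twistedOp_rbo lam h]
  have hm : extendRBA (fun ys => lHom lam (.alg 2 (mulCochain k A) :: ys))
      (xs.map fun x => (0, x)) ∈ AddMonoidHom.mker (AddMonoidHom.fst (CAlg k A) (CRBO k A)) :=
    extendRBA_rbo_mem _ _ _ fun ys hy => by
      match ys, hy with
      | [], hy => exact absurd (List.length_eq_zero_iff.mp hy.symm) h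
      | g :: gs, _ =>
        rw [lHom_alg_rbo]
        rfl
  have hm' : (extendRBA (fun ys => lHom lam (.alg 2 (mulCochain k A) :: ys))
    (xs.map fun x => ((0, x) : CRBA k A))).1 = 0 := hm
  rw [Prod.smul_fst, hm', smul_zero]

/-- At least three arguments cannot fit into the two slots of `m`. -/
theorem twistedOp_rbo_eq_zero (lam : k) {xs : List (CRBO k A)} (h : 3 ≤ xs.length) :
    twistedOp lam (mulElement k A) (xs.map fun x => (0, x)) = 0 := by
  rw [twistedOp_rbo lam (by rintro rfl; simp at h)]
  have hm : extendRBA (fun ys => lHom lam (.alg 2 (mulCochain k A) :: ys))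
      (xs.map fun x => (0, x)) ∈ (⊥ : AddSubmonoid (CRBA k A)) :=
    extendRBA_rbo_mem _ _ _ fun ys hy => by
      match ys, hy with
      | [], hy => simp at hy; omega
      | g :: gs, hy =>
        simp only [List.length_cons] at hy
        rw [lHom_alg_rbo, lMixed_eq_zero lam (by omega)]
        rfl
  rw [AddSubmonoid.mem_bot.mp hm, smul_zero]

theorem twistedOp_pair (lam : k) (x y : CRBO k A) :
    twistedOp lam (mulElement k A) [(0, x), (0, y)] = (0, bracketRBO lam x y) := by
  classical
  refine (twistedOp_rbo lam (xs := [x, y]) (by simp)).trans ?_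
  have hl (m n : ℕ) (f : HomRBO k A m) (g : HomRBO k A n) :
      lHom lam [.alg 2 (mulCochain k A), .rbo m f, .rbo n g]
        = (0, lMixed lam (mulCochain k A) (q := 1)
          ([⟨m, f⟩, ⟨n, g⟩] : List (Σ l : ℕ, HomRBO k A l)).get) :=
    lHom_alg_rbo lam (mulCochain k A) ⟨m, f⟩ [⟨n, g⟩]
  simp only [List.map_cons, List.map_nil, extendRBA_rbo_cons, extendRBA_nil, hl]
  rw [bracketRBO_apply]
  simp only [List.length_cons, List.length_nil, zero_add, Nat.reduceAdd, even_two, Even.neg_pow,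
    one_pow, one_smul]
  refine Prod.ext ?_ ?_
  · simp [DFinsupp.sum, Prod.fst_sum]
  · simp only [DFinsupp.sum, Prod.snd_sum]

variable [CharZero k]

/-- The coefficient `(-1)^1` of the surviving term cancels the minus sign of `wordRBO_lMixed_one`.
-/
theorem twistedOp_single (lam : k) (x : CRBO k A) :
    twistedOp lam (mulElement k A) [(0, x)] = (0, diffRBO lam x) := by
  classical
  refine (twistedOp_rbo lam (xs := [x]) (by simp)).trans ?_
  have hl (n : ℕ) (g : HomRBO k A n) : lHom lam [.alg 2 (mulCochain k A), .rbo n g]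
      = (0, -diffRBO lam (DFinsupp.single n g)) := by
    refine (lHom_alg_rbo lam (mulCochain k A) ⟨n, g⟩ []).trans (Prod.ext rfl ?_)
    apply wordRBO_injective
    refine (wordRBO_lMixed_one lam _).trans ?_
    rw [map_neg, wordRBO_diffRBO_single]
    rfl
  simp only [List.map_cons, List.map_nil, extendRBA_rbo_cons, extendRBA_nil, hl]
  rw [map_eq_sum_single (diffRBO lam) x]
  refine Prod.ext ?_ ?_
  · simp [DFinsupp.sum, Prod.fst_sum]
  · simp [DFinsupp.sum, Prod.snd_sum]

omit [CharZero k] in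
theorem brace_mulCochain_self :
    brace (DFinsupp.single 2 (mulCochain k A)) [DFinsupp.single 2 (mulCochain k A)] = 0 := by
  apply wordAlg_injective
  rw [wordAlg_brace_singleton _ (isHomogeneous_single _), wordAlg_mulCochain_eq, map_zero]
  exact WordFun.ins_letter_mul_letter

-- Every summand vanishes separately: `l₁` sees only arity `0`, `l₂` gives the Gerstenhaber square
-- of `m`, zero by associativity, and the higher operations vanish on entries of `𝔠_Alg(A)` alone.
omit [CharZero k] in
theorem isMaurerCartanRBA_mulElement (lam : k) : IsMaurerCartanRBA lam (mulElement k A) := by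
  have h1 (f : HomAlg k A 2) : lHom lam [.alg 2 f] = 0 := by simp [lHom, isolate, allRBO]
  have hl (f g : HomAlg k A 2) : lHom lam [.alg 2 f, .alg 2 g] = (gerstenhaberHom f g, 0) := rfl
  have h2 : lHom lam [.alg 2 (mulCochain k A), .alg 2 (mulCochain k A)] = 0 := by
    rw [hl, gerstenhaberHom, brace_mulCochain_self, smul_zero, sub_zero]
    rfl
  have hr (f : HomAlg k A 2) : lHom lam [.alg 2 f, .alg 2 0] = 0 := by
    rw [hl, gerstenhaberHom, DFinsupp.single_zero, brace_zero_left, brace_zero_right, smul_zero,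
      sub_zero]
    rfl
  have hL (g : HomAlg k A 2) : lHom lam [.alg 2 0, .alg 2 g] = 0 := by
    rw [hl, gerstenhaberHom, DFinsupp.single_zero, brace_zero_left, brace_zero_right, smul_zero,
      sub_zero]
    rfl
  have he (f : HomAlg k A 2) : extendRBA (fun ys => lHom lam (.alg 2 f :: ys)) [mulElement k A]
      = lHom lam [.alg 2 f, .alg 2 (mulCochain k A)] := extendRBA_alg_cons _ _ _ (hr f)
  have hα : lOp lam [mulElement k A] = 0 :=
    Eq.trans (extendRBA_alg_cons (lHom lam) (mulCochain k A) [] (h1 0)) (h1 (mulCochain k A))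
  have h0 (n : ℕ) : mcTerm lam (mulElement k A) n = 0 := by
    have h : lOp lam (List.replicate (n + 1) (mulElement k A)) = 0 := by
      match n with
      | 0 => exact hα
      | 1 => exact (extendRBA_alg_cons _ _ _ ((he 0).trans (hL _))).trans ((he _).trans h2)
      | n + 2 => exact lOp_alg_alg lam _ _ (by simp)
    rw [mcTerm, h, smul_zero]
  refine ⟨⟨fun n hn => ?_, (rboDegree k A (-1)).zero_mem⟩, ?_, ?_⟩
  · refine DFinsupp.single_eq_of_ne ?_
    rintro rfl
    exact hn (by norm_num)
  · rw [Function.support_eq_empty_iff.mpr (funext h0)]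
    exact Set.finite_empty
  · simp [h0]

end Components

end RotaBaxter

theorem mainTheorem8 {k : Type*} [Field k] [CharZero k] {A : Type*} [NonUnitalRing A] [Module k A]
    [IsScalarTower k A A] [SMulCommClass k A A] (lam : k) :
    -- the product of `A` gives a Maurer-Cartan element of `𝔠_RBA(A)`; the twisted operations exist
    RotaBaxter.IsMaurerCartanRBA lam (RotaBaxter.mulElement k A) ∧
    (∀ xs : List (RotaBaxter.CRBA k A), xs ≠ [] →
      (Function.support (RotaBaxter.twistedTerm lam (RotaBaxter.mulElement k A) xs)).Finite) ∧
    -- they preserve `𝔠_RBO(A)`, and on it they vanish in arities at least `3`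
    (∀ xs : List (RotaBaxter.CRBO k A), xs ≠ [] →
      (RotaBaxter.twistedOp lam (RotaBaxter.mulElement k A) (xs.map fun x => (0, x))).1 = 0) ∧
    (∀ xs : List (RotaBaxter.CRBO k A), 3 ≤ xs.length →
      RotaBaxter.twistedOp lam (RotaBaxter.mulElement k A) (xs.map fun x => (0, x)) = 0) ∧
    -- the restricted `l₁` and `l₂` form a dg Lie algebra
    ∃ D : RotaBaxter.DGLieAlgebra k (RotaBaxter.CRBO k A) (RotaBaxter.rboDegree k A),
      (∀ x : RotaBaxter.CRBO k A,
        RotaBaxter.twistedOp lam (RotaBaxter.mulElement k A) [(0, x)] = (0, D.l₁ x)) ∧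
      (∀ x y : RotaBaxter.CRBO k A,
        RotaBaxter.twistedOp lam (RotaBaxter.mulElement k A) [(0, x), (0, y)]
          = (0, D.l₂ x y)) ∧
      -- its Maurer-Cartan elements are the Rota-Baxter operators of weight `lam`
      Set.BijOn RotaBaxter.operatorElement {T : A →ₗ[k] A | RotaBaxter.IsRotaBaxter lam T}
        {β : RotaBaxter.CRBO k A | D.IsMaurerCartan β} ∧
      -- twisting by a Rota-Baxter operator `T` gives the cochain complex of `T`
      ∀ (T : A →ₗ[k] A), RotaBaxter.IsRotaBaxter lam T →
        ∀ hT : D.IsMaurerCartan (RotaBaxter.operatorElement T),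
          (∀ (n : ℕ) (f : MultilinearMap k (fun _ : Fin n => A) A),
            RotaBaxter.rboDiff lam T (RotaBaxter.rboDiff lam T f) = 0) ∧
          ∀ (n : ℕ) (g : RotaBaxter.HomRBO k A n),
            (D.twist (RotaBaxter.operatorElement T) hT).l₁ (DFinsupp.single n g) =
              DFinsupp.single (n + 1) ((RotaBaxter.hat k A (n + 1)).symm
                (RotaBaxter.rboDiff lam T (RotaBaxter.hat k A n g))) := by
  refine ⟨RotaBaxter.isMaurerCartanRBA_mulElement lam,
    fun xs h => RotaBaxter.support_twistedTerm_finite lam h,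
    fun xs h => RotaBaxter.twistedOp_rbo_fst lam h,
    fun xs h => RotaBaxter.twistedOp_rbo_eq_zero lam h, RotaBaxter.dgLieRBO k A lam,
    RotaBaxter.twistedOp_single lam, RotaBaxter.twistedOp_pair lam,
    RotaBaxter.bijOn_operatorElement lam, fun T hT hT' =>
      ⟨fun n f => RotaBaxter.rboDiff_rboDiff lam hT f,
        fun n g => RotaBaxter.twist_l₁_single lam T hT' g⟩⟩
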